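/- **Theorem (semi-classical limit of quantum Birkhoff normal forms).** Let $d\ge 1$ and let $\omega=(\omega_1,\dots,\omega_d)$ with $\omega_1,\dots,\omega_d>0$ be arbitrary (no Diophantine or non-resonance hypothesis). On $T^*\mathbb R^d=\mathbb R^d\times\mathbb R^d\ni(x,\xi)$ let $\{f,g\}=\sum_j(\partial_{x_j}f\,\partial_{\xi_j}g-\partial_{\xi_j}f\,\partial_{x_j}g)$, $\sigma_0=\sum_j\frac12(\xi_j^2+\omega_j^2x_j^2)$ and, for $n\in\mathbb Z^d$, $\lambda(n)=\mathrm i\,\langle n,\omega\rangle$. Put $y_j=\xi_j/\omega_j$, $z_j=\frac1{\sqrt2}(x_j+\mathrm i y_j)$, $w_j=\frac1{\sqrt2}(\mathrm i x_j+y_j)$. *Symbols.* For $\mathbf k=\mathbb R$ or $\mathbb C$, let $\mathscr S_0^{\mathbf k}$ be the set of $\mathbf k$-valued Schwartz functions on $\mathbb R^d\times\mathbb R^d$ of the form $\tilde f\big(\frac{x_1^2+y_1^2}2,\dots,\frac{x_d^2+y_d^2}2\big)$ with $\tilde f\in C^\infty((\mathbb R_{\ge0})^d,\mathbf k)$, and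 let $\mathscr S^{\mathbf k}$ be the set of finite sums $\sum b_{k,\ell}\,x^ky^\ell$ with $k,\ell\in\mathbb N^d$ and $b_{k,\ell}\in\mathscr S_0^{\mathbf k}$. Let $B^{\rm cl}=\sum_{m\ge1}\varepsilon^mB^{\rm cl}_{(m)}$ with $B^{\rm cl}_{(m)}\in\mathscr S^{\mathbb R}$. There is exactly one decomposition $B^{\rm cl}=\sum_{n\in\mathbb Z^d}B^{\rm cl}_n$ in which, for every $m$, the coefficient of $\varepsilon^m$ in $B^{\rm cl}_n$ is nonzero for only finitely many $n$ and is, for each $n$, a finite sum $\sum c_{k,\ell}\,z^kw^\ell$ with $k-\ell=n$ and $c_{k,\ell}\in\mathscr S^{\mathbb C}_0$. *Moulds.* A mould is a map $M^\bullet$ from the set of words $\lambda_1\cdots\lambda_r$ ($r\ge0$) over the alphabet $\mathbb C$ to $\mathbb C$; the product is $(M\times N)^{\underline n}=\sum_{\underline n=\underline a\,\underline b}M^{\underline a}N^{\underline b}$, with the corresponding exponential for moulds vanishing on the empty word; $\nabla M^{\lambda_1\cdots\lambda_r}=(\lambda_1+\dots+\lambda_r)M^{\lambda_1\cdots\lambda_r}$;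 $I^\bullet$ is $1$ on one-letter words and $0$ on all others; $M^\bullet$ is alternal if it vanishes on the empty word and, for all nonempty words $\underline a,\underline b$, the sum of $M^{\underline n}$ over all shuffles $\underline n$ of $\underline a$ and $\underline b$, counted with multiplicity, is $0$. Let $(F^\bullet,G^\bullet)$ be any pair of alternal moulds such that $\nabla F^\bullet=0$ and $\nabla(\mathrm e^{G^\bullet})=I^\bullet\times\mathrm e^{G^\bullet}-\mathrm e^{G^\bullet}\times F^\bullet$. *Normal forms.* For $\hbar>0$ the Weyl quantization of a complex Schwartz function $\sigma$ is the bounded operator of $L^2(\mathbb R^d)$ $$\varphi\mapsto\int_{\mathbb R^d\times\mathbb R^d}\sigma\Big(\frac{x+y}2,\xi\Big)\,\mathrm e^{\mathrm i\,\xi\cdot(x-y)/\hbar}\,\varphi(y)\,\frac{\mathrm d\xi\,\mathrm dy}{(2\pi\hbar)^d},$$ and $\sigma$ is called the symbol of this operator. Let $B^{\rm qu}_n$ be the Weyl quantization of $B^{\rm cl}_n$, coefficient by coefficient in $\varepsilon$, and let $[A,B]_{\rm qu}=\frac1{\mathrm i\hbar}(AB-BA)$. The classical Birkhoff normal form $\sigma_0+Z^{\rm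 cl}$ of $\sigma_0+B^{\rm cl}$ and the quantum Birkhoff normal form $X_0+Z^{\rm qu}$ of the Weyl quantization of $\sigma_0+B^{\rm cl}$, where $X_0=-\frac12\hbar^2\Delta+\sum_j\frac12\omega_j^2x_j^2$, are those built with the same mould $F^\bullet$: $$Z^{\rm cl}=\sum_{r\ge1}\sum_{n_1,\dots,n_r\in\mathbb Z^d}\frac1rF^{\lambda(n_1)\cdots\lambda(n_r)}\{B^{\rm cl}_{n_r},\{\dots\{B^{\rm cl}_{n_2},B^{\rm cl}_{n_1}\}\dots\}\},$$ $$Z^{\rm qu}=\sum_{r\ge1}\sum_{n_1,\dots,n_r\in\mathbb Z^d}\frac1rF^{\lambda(n_1)\cdots\lambda(n_r)}[B^{\rm qu}_{n_r},[\dots[B^{\rm qu}_{n_2},B^{\rm qu}_{n_1}]_{\rm qu}\dots]_{\rm qu}]_{\rm qu}$$ (for each $m$, only finitely many terms contribute to the coefficient of $\varepsilon^m$). *Conclusion.* For every $m\ge0$ and every $\hbar>0$, the coefficient of $\varepsilon^m$ in $Z^{\rm qu}$ has exactly one Schwartz symbol and, as $\hbar\to0^+$, this symbol converges, in the topology of the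 Schwartz space $\mathcal S(\mathbb R^d\times\mathbb R^d)$, to the coefficient of $\varepsilon^m$ in $Z^{\rm cl}$. -/

import Mathlib

open MeasureTheory Filter Topology
open scoped ENNReal SchwartzMap

noncomputable section
namespace WeylBNF

/-! ### Moulds -/

/-- Moulds: maps from the words over the alphabet `N` to `k`. -/
abbrev Mould (N k : Type*) : Type _ := List N → k

section Moulds

variable {N k : Type*} [Field k]

/-- Mould multiplication: the sum over all factorizations of the word into two words. -/
def mouldMul (M M' : Mould N k) : Mould N k := fun w =>
  ∑ i ∈ Finset.range (w.length + 1), M (w.take i) * M' (w.drop i)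

/-- The unit mould. -/
def mouldOne : Mould N k
  | [] => 1
  | _ :: _ => 0

/-- The mould `I`, equal to `1` on one-letter words and to `0` on the other ones. -/
def mouldI : Mould N k := fun w => if w.length = 1 then 1 else 0

/-- Powers for mould multiplication. -/
def mouldPow (M : Mould N k) : ℕ → Mould N k
  | 0 => mouldOne
  | r + 1 => mouldMul M (mouldPow M r)

/-- The exponential of a mould `M` that vanishes on the empty word. For such an `M`, the `r`-th
power vanishes on the words of length `< r`, so the exponential series stops at `r = length`. -/
def mouldExp (M : Mould N k) : Mould N k := fun w =>
  ∑ r ∈ Finset.range (w.length + 1), ((r.factorial : k))⁻¹ * mouldPow M r w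

/-- The derivation `∇_φ`, which multiplies `M` on `n₁⋯n_r` by `φ(n₁) + ⋯ + φ(n_r)`. -/
def mouldNabla (φ : N → k) (M : Mould N k) : Mould N k := fun w => (w.map φ).sum * M w

/-- The word `n_{τ(1)} ⋯ n_{τ(r)}`. -/
def permWord (w : List N) (τ : Equiv.Perm (Fin w.length)) : List N :=
  List.ofFn fun i => w.get (τ i)

/-- The shuffling coefficient of the word `w` in the pair of words `(a, b)`. -/
def shuffleCoeff (a b w : List N) : ℕ :=
  Nat.card {τ : Equiv.Perm (Fin w.length) //
    (∀ i j : Fin w.length, i < j → (j : ℕ) < a.length → τ i < τ j) ∧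
    (∀ i j : Fin w.length, i < j → a.length ≤ (i : ℕ) → τ i < τ j) ∧
    (permWord w τ).take a.length = a ∧ (permWord w τ).drop a.length = b}

/-- Alternal moulds. The sum has finite support: only the rearrangements of `a ++ b` contribute. -/
def IsAlternal (M : Mould N k) : Prop :=
  M [] = 0 ∧ ∀ a b : List N, a ≠ [] → b ≠ [] →
    ∑ᶠ w : List N, (shuffleCoeff a b w : k) * M w = 0

/-- The mould equation `∇_φ F = 0`, `∇_φ (e^G) = I × e^G - e^G × F`. -/
def MouldEquation (φ : N → k) (F G : Mould N k) : Prop :=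
  mouldNabla φ F = 0 ∧
    mouldNabla φ (mouldExp G) = mouldMul mouldI (mouldExp G) - mouldMul (mouldExp G) F

end Moulds

/-! ### Mould expansions in `L[[ε]]`

A formal series `∑ ε^m f_m` with coefficients in `L` is the sequence `f : ℕ → L`. -/

section Expansions

variable {N L : Type*} [AddCommGroup L]

/-- The extension to `L[[ε]]` of a bracket `br` of `L`. -/
def seriesBracket (br : L → L → L) (f g : ℕ → L) : ℕ → L := fun m =>
  ∑ p ∈ Finset.HasAntidiagonal.antidiagonal m, br (f p.1) (g p.2)

/-- The Lie comould: `n₁⋯n_r ↦ [B_{n_r}, [⋯ [B_{n₂}, B_{n₁}] ⋯ ]]`, and `0` on the empty word. -/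
def lieComould (br : L → L → L) (B : N → ℕ → L) : List N → ℕ → L
  | [] => 0
  | n :: w => w.foldl (fun acc n' => seriesBracket br (B n') acc) (B n)

/-- The coefficient of `ε^m` in
`∑_{r ≥ 1} ∑_{n₁,…,n_r} (1/r) F^{φ(n₁)⋯φ(n_r)} [B_{n_r}, [⋯ [B_{n₂}, B_{n₁}] ⋯ ]]`.
If each `B_n` has order `≥ 1` in `ε` and, for each `m`, only finitely many of the `B_n` have a nonzero
coefficient of `ε^m`, then only finitely many words contribute to this coefficient. -/
def mouldExpansion [Module ℂ L] (br : L → L → L) (F : Mould ℂ ℂ) (φ : N → ℂ) (B : N → ℕ → L)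
    (m : ℕ) : L :=
  ∑ᶠ w : List N, ((w.length : ℂ)⁻¹ * F (w.map φ)) • lieComould br B w m

end Expansions

/-! ### Classical side -/

/-- The configuration space `ℝᵈ`. -/
abbrev Config (d : ℕ) : Type := EuclideanSpace ℝ (Fin d)
/-- The phase space `ℝᵈ × ℝᵈ`, with points `(x, ξ)`. -/
abbrev Phase (d : ℕ) : Type := Config d × Config d
/-- The Poisson bracket `∑ⱼ (∂f/∂xⱼ ∂g/∂ξⱼ - ∂f/∂ξⱼ ∂g/∂xⱼ)`. -/
def poissonBracket {d : ℕ} (f g : 𝓢(Phase d, ℂ)) : 𝓢(Phase d, ℂ) :=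
  ∑ j : Fin d,
    (SchwartzMap.pairing (ContinuousLinearMap.mul ℂ ℂ)
        (LineDeriv.lineDerivOp ((EuclideanSpace.single j 1, 0) : Phase d) f)
        (LineDeriv.lineDerivOp ((0, EuclideanSpace.single j 1) : Phase d) g) -
      SchwartzMap.pairing (ContinuousLinearMap.mul ℂ ℂ)
        (LineDeriv.lineDerivOp ((0, EuclideanSpace.single j 1) : Phase d) f)
        (LineDeriv.lineDerivOp ((EuclideanSpace.single j 1, 0) : Phase d) g))

/-- The eigenvalue map `λ(n) = i ⟨n, ω⟩`. -/
def eigenvalue {d : ℕ} (ω : Fin d → ℝ) (n : Fin d → ℤ) : ℂ :=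
  Complex.I * ∑ j, (n j : ℂ) * (ω j : ℂ)

/-- The rescaled momentum `yⱼ = ξⱼ / ωⱼ`, for which `½ (ξⱼ² + ωⱼ² xⱼ²) = ½ ωⱼ² (xⱼ² + yⱼ²)`. -/
def yCoord {d : ℕ} (ω : Fin d → ℝ) (j : Fin d) (p : Phase d) : ℝ := p.2 j / ω j

/-- `zⱼ = (xⱼ + i yⱼ) / √2`. -/
def zCoord {d : ℕ} (ω : Fin d → ℝ) (j : Fin d) (p : Phase d) : ℂ :=
  ((p.1 j : ℂ) + Complex.I * (yCoord ω j p : ℂ)) / (√2 : ℝ)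

/-- `wⱼ = (i xⱼ + yⱼ) / √2`. -/
def wCoord {d : ℕ} (ω : Fin d → ℝ) (j : Fin d) (p : Phase d) : ℂ :=
  (Complex.I * (p.1 j : ℂ) + (yCoord ω j p : ℂ)) / (√2 : ℝ)

/-- Schwartz functions which are smooth functions of the `d` variables `½ (xⱼ² + yⱼ²)`. -/
def IsActionFunction {d : ℕ} {𝕜 : Type*} [RCLike 𝕜] (ω : Fin d → ℝ) (f : 𝓢(Phase d, 𝕜)) : Prop :=
  ∃ g : (Fin d → ℝ) → 𝕜, ContDiffOn ℝ ((⊤ : ℕ∞) : WithTop ℕ∞) g {t | ∀ j, 0 ≤ t j} ∧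
    ∀ p, f p = g fun j => (p.1 j ^ 2 + yCoord ω j p ^ 2) / 2

/-- Finite sums `∑ b_{k,l} x^k y^l` whose coefficients `b_{k,l}` are action functions. -/
def IsAdmissible {d : ℕ} {𝕜 : Type*} [RCLike 𝕜] (ω : Fin d → ℝ) (f : 𝓢(Phase d, 𝕜)) : Prop :=
  ∃ (Ω : Finset ((Fin d → ℕ) × (Fin d → ℕ))) (b : (Fin d → ℕ) × (Fin d → ℕ) → 𝓢(Phase d, 𝕜)),
    (∀ κ ∈ Ω, IsActionFunction ω (b κ)) ∧
    ∀ p, f p = ∑ κ ∈ Ω, b κ p *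
      ∏ j, ((p.1 j ^ κ.1 j * yCoord ω j p ^ κ.2 j : ℝ) : 𝕜)

/-- Finite sums `∑ c_{k,l} z^k w^l` with `k - l = n` whose coefficients `c_{k,l}` are complex
action functions. -/
def IsHomogeneous {d : ℕ} (ω : Fin d → ℝ) (n : Fin d → ℤ) (f : 𝓢(Phase d, ℂ)) : Prop :=
  ∃ (Ω : Finset ((Fin d → ℕ) × (Fin d → ℕ))) (c : (Fin d → ℕ) × (Fin d → ℕ) → 𝓢(Phase d, ℂ)),
    (∀ κ ∈ Ω, IsActionFunction ω (c κ) ∧ ∀ j, (κ.1 j : ℤ) - (κ.2 j : ℤ) = n j) ∧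
    ∀ p, f p = ∑ κ ∈ Ω, c κ p * ∏ j, (zCoord ω j p ^ κ.1 j * wCoord ω j p ^ κ.2 j)

/-- `(B_n)_{n ∈ ℤᵈ}` is the decomposition of the formal series `B = ∑ ε^m B_m` into a formally
summable series of homogeneous components; `Bn n m` is the coefficient of `ε^m` in `B_n`. -/
def IsHomogeneousDecomposition {d : ℕ} (ω : Fin d → ℝ) (B : ℕ → 𝓢(Phase d, ℝ))
    (Bn : (Fin d → ℤ) → ℕ → 𝓢(Phase d, ℂ)) : Prop :=
  ∀ m : ℕ, (∀ n, IsHomogeneous ω n (Bn n m)) ∧ {n | Bn n m ≠ 0}.Finite ∧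
    ∀ p, ((B m p : ℝ) : ℂ) = ∑ᶠ n, Bn n m p

/-- The coefficient of `ε^m` in `Z^cl`, given the mould `F` and the homogeneous components `B_n`
of the classical perturbation. -/
def classicalZ {d : ℕ} (ω : Fin d → ℝ) (F : Mould ℂ ℂ) (Bn : (Fin d → ℤ) → ℕ → 𝓢(Phase d, ℂ))
    (m : ℕ) : 𝓢(Phase d, ℂ) :=
  mouldExpansion poissonBracket F (eigenvalue ω) Bn m

/-! ### Weyl quantization -/

/-- The Hilbert space `L²(ℝᵈ)`. -/
abbrev L2 (d : ℕ) : Type := Lp ℂ 2 (volume : Measure (Config d))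

/-- Schur's bound for operators whose kernel is a function of `x + y`. -/
theorem lintegral_schur {d : ℕ} (H f : Config d → ℝ≥0∞) (hH : Measurable H) (hf : Measurable f) :
    ∫⁻ x, (∫⁻ y, H (x + y) * f y) ^ 2 ≤ (∫⁻ y, H y) ^ 2 * ∫⁻ y, f y ^ 2 := by
  have hHm : ∀ x, Measurable fun y => H (x + y) := fun x => hH.comp (measurable_const_add x)
  have key : ∀ x, (∫⁻ y, H (x + y) * f y) ^ 2 ≤ (∫⁻ y, H y) * ∫⁻ y, H (x + y) * f y ^ 2 := by
    intro x
    have h := ENNReal.lintegral_mul_le_Lp_mul_Lq (volume : Measure (Config d))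
      Real.HolderConjugate.two_two
      (f := fun y => H (x + y) ^ (1 / 2 : ℝ)) (g := fun y => H (x + y) ^ (1 / 2 : ℝ) * f y)
      ((hHm x).pow_const _).aemeasurable (((hHm x).pow_const _).mul hf).aemeasurable
    have e1 : ∀ a : ℝ≥0∞, (a ^ (1 / 2 : ℝ)) ^ (2 : ℝ) = a := fun a => by
      rw [← ENNReal.rpow_mul]; norm_num
    have e2 : ∀ a : ℝ≥0∞, a ^ (1 / 2 : ℝ) * a ^ (1 / 2 : ℝ) = a := fun a => by
      rw [← pow_two, ← ENNReal.rpow_two, e1]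
    simp only [Pi.mul_apply, ENNReal.mul_rpow_of_nonneg _ _ (by norm_num : (0 : ℝ) ≤ 2), e1,
      ← mul_assoc, e2, ENNReal.rpow_two] at h
    calc _ ≤ _ := pow_le_pow_left' h 2
      _ = _ := by
        rw [mul_pow, ← ENNReal.rpow_two, e1, ← ENNReal.rpow_two, e1,
          lintegral_add_left_eq_self H x]
  calc _ ≤ ∫⁻ x, (∫⁻ y, H y) * ∫⁻ y, H (x + y) * f y ^ 2 := lintegral_mono key
    _ = (∫⁻ y, H y) * ∫⁻ x, ∫⁻ y, H (x + y) * f y ^ 2 := by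
        refine lintegral_const_mul _ ?_
        exact Measurable.lintegral_prod_right
          ((hH.comp (measurable_fst.add measurable_snd)).mul ((hf.comp measurable_snd).pow_const 2))
    _ = (∫⁻ y, H y) * ∫⁻ y, ∫⁻ x, H (x + y) * f y ^ 2 := by
        rw [lintegral_lintegral_swap]
        exact ((hH.comp (measurable_fst.add measurable_snd)).mul
          ((hf.comp measurable_snd).pow_const 2)).aemeasurable
    _ = (∫⁻ y, H y) * ∫⁻ y, (∫⁻ x, H x) * f y ^ 2 := by
        congr 1
        refine lintegral_congr fun y => ?_
        rw [lintegral_mul_const _ (by exact hH.comp (measurable_add_const y)),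
          lintegral_add_right_eq_self H y]
    _ = _ := by
        rw [lintegral_const_mul _ (hf.pow_const 2)]; ring

/-- The polynomially decaying weight `(1 + ‖v‖) ^ (-(d + 1))`. -/
def decayWeight {d : ℕ} (v : Config d) : ℝ := (1 + ‖v‖) ^ (-(d + 1 : ℝ))

theorem continuous_decayWeight {d : ℕ} : Continuous (decayWeight (d := d)) := by
  unfold decayWeight
  refine Continuous.rpow_const (by fun_prop) fun v => Or.inl ?_
  positivity

theorem decayWeight_nonneg {d : ℕ} (v : Config d) : 0 ≤ decayWeight v := by
  unfold decayWeight; positivity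

theorem integrable_decayWeight {d : ℕ} : Integrable (decayWeight (d := d)) := by
  unfold decayWeight
  exact integrable_one_add_norm (by simp)

theorem norm_symbol_le {d : ℕ} (σ : 𝓢(Phase d, ℂ)) :
    ∃ C : ℝ, 0 ≤ C ∧ ∀ q ξ, ‖σ (q, ξ)‖ ≤ C * (decayWeight q * decayWeight ξ) := by
  have h := fun p => SchwartzMap.one_add_le_sup_seminorm_apply (𝕜 := ℝ) (m := (2 * (d + 1), 0))
    le_rfl le_rfl σ p
  set C := 2 ^ (2 * (d + 1)) *
    ((Finset.Iic (2 * (d + 1), 0)).sup fun m => SchwartzMap.seminorm ℝ m.1 m.2) σ with hC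
  refine ⟨C, by positivity, fun q ξ => ?_⟩
  have h' := h (q, ξ)
  rw [norm_iteratedFDeriv_zero] at h'
  have e : ∀ v : Config d, decayWeight v = ((1 + ‖v‖) ^ (d + 1))⁻¹ := fun v => by
    unfold decayWeight
    rw [Real.rpow_neg (by positivity)]; norm_cast
  rw [e, e, ← mul_inv, ← div_eq_mul_inv, le_div_iff₀ (by positivity), mul_comm]
  refine le_trans ?_ h'
  refine mul_le_mul_of_nonneg_right ?_ (norm_nonneg _)
  change (1 + ‖q‖) ^ (d + 1) * (1 + ‖ξ‖) ^ (d + 1) ≤ (1 + ‖(q, ξ)‖) ^ (2 * (d + 1))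
  rw [two_mul, pow_add (1 + ‖(q, ξ)‖) (d + 1) (d + 1)]
  have h1 : ‖q‖ ≤ ‖(q, ξ)‖ := norm_fst_le (q, ξ)
  have h2 : ‖ξ‖ ≤ ‖(q, ξ)‖ := norm_snd_le (q, ξ)
  gcongr

/-- The integrand of the Weyl quantization formula at `x`, as a function of `(y, ξ)`. -/
def weylIntegrand {d : ℕ} (ħ : ℝ) (σ : 𝓢(Phase d, ℂ)) (φ : Config d → ℂ) (x : Config d)
    (p : Config d × Config d) : ℂ :=
  σ ((1 / 2 : ℝ) • (x + p.1), p.2) * Complex.exp (Complex.I * (inner ℝ p.2 (x - p.1) : ℝ) / (ħ : ℂ)) *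
    φ p.1 / (2 * Real.pi * ħ : ℂ) ^ d

/-- The function `x ↦ ∫ σ((x+y)/2, ξ) e^{i ξ·(x-y)/ħ} φ(y) dξ dy / (2πħ)^d`. -/
def weylFun {d : ℕ} (ħ : ℝ) (σ : 𝓢(Phase d, ℂ)) (φ : Config d → ℂ) (x : Config d) : ℂ :=
  ∫ p : Config d × Config d, weylIntegrand ħ σ φ x p

theorem norm_weylIntegrand {d : ℕ} (ħ : ℝ) (σ : 𝓢(Phase d, ℂ)) (φ : Config d → ℂ) (x : Config d)
    (p : Config d × Config d) : ‖weylIntegrand ħ σ φ x p‖ =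
      ‖σ ((1 / 2 : ℝ) • (x + p.1), p.2)‖ * ‖φ p.1‖ / ‖(2 * Real.pi * ħ : ℂ) ^ d‖ := by
  have : Complex.I * (inner ℝ p.2 (x - p.1) : ℝ) / (ħ : ℂ)
      = ((inner ℝ p.2 (x - p.1) / ħ : ℝ) : ℂ) * Complex.I := by
    push_cast; ring
  rw [weylIntegrand, norm_div, norm_mul, norm_mul, this, Complex.norm_exp_ofReal_mul_I, mul_one]

theorem stronglyMeasurable_weylIntegrand {d : ℕ} (ħ : ℝ) (σ : 𝓢(Phase d, ℂ)) {φ : Config d → ℂ}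
    (hφ : StronglyMeasurable φ) :
    StronglyMeasurable fun z : Config d × (Config d × Config d) =>
      weylIntegrand ħ σ φ z.1 z.2 := by
  unfold weylIntegrand
  have h1 : Continuous fun z : Config d × (Config d × Config d) =>
      σ ((1 / 2 : ℝ) • (z.1 + z.2.1), z.2.2) := σ.continuous.comp (by fun_prop)
  have h2 : Continuous fun z : Config d × (Config d × Config d) =>
      Complex.exp (Complex.I * (inner ℝ z.2.2 (z.1 - z.2.1) : ℝ) / (ħ : ℂ)) := by fun_prop
  have h3 := hφ.comp_measurable (measurable_fst.comp measurable_snd :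
    Measurable fun z : Config d × (Config d × Config d) => z.2.1)
  exact ((h1.stronglyMeasurable.mul h2.stronglyMeasurable).mul h3).div
    stronglyMeasurable_const

/-- The convolution weight that dominates Weyl operators. -/
def schurWeight {d : ℕ} (y : Config d) : ℝ≥0∞ := ENNReal.ofReal (decayWeight ((1 / 2 : ℝ) • y))

theorem measurable_schurWeight {d : ℕ} : Measurable (schurWeight (d := d)) :=
  (continuous_decayWeight.comp (continuous_const_smul _)).measurable.ennreal_ofReal

theorem lintegral_schurWeight_lt_top {d : ℕ} : ∫⁻ y, schurWeight (d := d) y < ⊤ := by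
  have : Integrable fun y : Config d => decayWeight ((1 / 2 : ℝ) • y) :=
    integrable_decayWeight.comp_smul (by norm_num)
  have h := this.hasFiniteIntegral
  rw [hasFiniteIntegral_iff_ofReal (.of_forall fun _ => decayWeight_nonneg _)] at h
  exact h

theorem lintegral_weylIntegrand_le {d : ℕ} (ħ : ℝ) (σ : 𝓢(Phase d, ℂ)) :
    ∃ K : ℝ≥0∞, K ≠ ⊤ ∧ ∀ (φ : Config d → ℂ), StronglyMeasurable φ → ∀ x,
      ∫⁻ p, ‖weylIntegrand ħ σ φ x p‖ₑ ≤ K * ∫⁻ y, schurWeight (x + y) * ‖φ y‖ₑ := by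
  obtain ⟨C, hC, hσ⟩ := norm_symbol_le σ
  set c := ‖(2 * Real.pi * ħ : ℂ) ^ d‖ with hc
  refine ⟨ENNReal.ofReal (C / c) * ∫⁻ ξ : Config d, ENNReal.ofReal (decayWeight ξ), ?_, ?_⟩
  · refine ENNReal.mul_ne_top ENNReal.ofReal_ne_top ?_
    have h := (integrable_decayWeight (d := d)).hasFiniteIntegral
    rw [hasFiniteIntegral_iff_ofReal (.of_forall fun _ => decayWeight_nonneg _)] at h
    exact h.ne
  · intro φ hφ x
    have hφm : Measurable fun y => ‖φ y‖ₑ := hφ.enorm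
    have hA : Measurable fun y => schurWeight (x + y) * ‖φ y‖ₑ :=
      (measurable_schurWeight.comp (measurable_const_add x)).mul hφm
    have hB : Measurable fun ξ : Config d => ENNReal.ofReal (decayWeight ξ) :=
      continuous_decayWeight.measurable.ennreal_ofReal
    calc ∫⁻ p, ‖weylIntegrand ħ σ φ x p‖ₑ
        ≤ ∫⁻ p : Config d × Config d, ENNReal.ofReal (C / c) *
            ((schurWeight (x + p.1) * ‖φ p.1‖ₑ) * ENNReal.ofReal (decayWeight p.2)) := by
          refine lintegral_mono fun p => ?_
          rw [← ofReal_norm, ← ofReal_norm, norm_weylIntegrand, schurWeight,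
            ← ENNReal.ofReal_mul (decayWeight_nonneg _),
            ← ENNReal.ofReal_mul (mul_nonneg (decayWeight_nonneg _) (norm_nonneg _)),
            ← ENNReal.ofReal_mul (by positivity)]
          refine ENNReal.ofReal_le_ofReal ?_
          rw [← hc]
          calc _ ≤ (C * (decayWeight ((1 / 2 : ℝ) • (x + p.1)) * decayWeight p.2)) * ‖φ p.1‖ / c := by
                gcongr; exact hσ _ _
            _ = _ := by ring
      _ = _ := by
          rw [lintegral_const_mul _ (by exact (hA.comp measurable_fst).mul (hB.comp measurable_snd)),
            Measure.volume_eq_prod, lintegral_prod_mul hA.aemeasurable hB.aemeasurable]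
          ring

theorem enorm_sq_lintegral {d : ℕ} (f : Config d → ℂ) :
    eLpNorm f 2 volume = (∫⁻ y, ‖f y‖ₑ ^ 2) ^ (1 / 2 : ℝ) := by
  rw [eLpNorm_eq_lintegral_rpow_enorm_toReal (by norm_num) (by norm_num)]
  simp

theorem integrable_weylIntegrand {d : ℕ} (ħ : ℝ) (σ : 𝓢(Phase d, ℂ)) (φ : L2 d) (x : Config d) :
    Integrable (weylIntegrand ħ σ φ x) := by
  have hφ := Lp.stronglyMeasurable φ
  refine ⟨((stronglyMeasurable_weylIntegrand ħ σ hφ).comp_measurable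
    measurable_prodMk_left).aestronglyMeasurable, ?_⟩
  obtain ⟨K, hK, h⟩ := lintegral_weylIntegrand_le ħ σ
  refine lt_of_le_of_lt (h φ hφ x) (ENNReal.mul_lt_top hK.lt_top ?_)
  have hw : ∀ y : Config d, schurWeight y ≤ 1 := fun y => by
    unfold schurWeight decayWeight
    rw [ENNReal.ofReal_le_one]
    exact Real.rpow_le_one_of_one_le_of_nonpos (by simp) (by linarith [Nat.cast_nonneg (α := ℝ) d])
  have h2 : ∀ a b : ℝ≥0∞, a ≤ 1 → a * b ≤ a + b ^ 2 := fun a b ha => by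
    rcases le_total b 1 with hb | hb
    · exact (mul_le_of_le_one_right' hb).trans le_self_add
    · calc a * b ≤ 1 * b ^ 2 := by
            gcongr; exact le_self_pow hb (by norm_num)
        _ ≤ _ := by rw [one_mul]; exact le_add_self
  have h3 : ∫⁻ y, ‖φ y‖ₑ ^ 2 < ⊤ := by
    have := Lp.eLpNorm_lt_top φ
    rw [enorm_sq_lintegral] at this
    by_contra hne
    rw [not_lt, top_le_iff] at hne
    rw [hne] at this
    simp at this
  calc ∫⁻ y, schurWeight (x + y) * ‖φ y‖ₑ ≤ ∫⁻ y, (schurWeight (x + y) + ‖φ y‖ₑ ^ 2) :=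
        lintegral_mono fun y => h2 _ _ (hw _)
    _ = (∫⁻ y, schurWeight (d := d) y) + ∫⁻ y, ‖φ y‖ₑ ^ 2 := by
        rw [lintegral_add_left (by exact measurable_schurWeight.comp (measurable_const_add x)),
          lintegral_add_left_eq_self schurWeight x]
    _ < ⊤ := ENNReal.add_lt_top.2 ⟨lintegral_schurWeight_lt_top, h3⟩

theorem weylFun_bound {d : ℕ} (ħ : ℝ) (σ : 𝓢(Phase d, ℂ)) :
    ∃ K : ℝ≥0∞, K ≠ ⊤ ∧ ∀ φ : L2 d, MemLp (weylFun ħ σ φ) 2 volume ∧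
      eLpNorm (weylFun ħ σ φ) 2 volume ≤ K * eLpNorm φ 2 volume := by
  obtain ⟨K, hK, h⟩ := lintegral_weylIntegrand_le ħ σ
  have hKA : K * ∫⁻ y, schurWeight (d := d) y ≠ ⊤ :=
    ENNReal.mul_ne_top hK lintegral_schurWeight_lt_top.ne
  refine ⟨K * ∫⁻ y, schurWeight (d := d) y, hKA, fun φ => ?_⟩
  have hφ := Lp.stronglyMeasurable φ
  have hb : eLpNorm (weylFun ħ σ φ) 2 volume ≤
      (K * ∫⁻ y, schurWeight (d := d) y) * eLpNorm φ 2 volume := by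
    rw [enorm_sq_lintegral, enorm_sq_lintegral]
    have e : (K * ∫⁻ y, schurWeight (d := d) y) =
        ((K * ∫⁻ y, schurWeight (d := d) y) ^ 2) ^ (1 / 2 : ℝ) := by
      rw [← ENNReal.rpow_two, ← ENNReal.rpow_mul]; norm_num
    rw [e, ← ENNReal.mul_rpow_of_nonneg _ _ (by norm_num)]
    refine ENNReal.rpow_le_rpow ?_ (by norm_num)
    calc ∫⁻ x, ‖weylFun ħ σ φ x‖ₑ ^ 2
        ≤ ∫⁻ x, K ^ 2 * (∫⁻ y, schurWeight (x + y) * ‖φ y‖ₑ) ^ 2 := by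
          refine lintegral_mono fun x => ?_
          rw [← mul_pow]
          exact pow_le_pow_left' ((enorm_integral_le_lintegral_enorm _).trans (h φ hφ x)) 2
      _ = K ^ 2 * ∫⁻ x, (∫⁻ y, schurWeight (x + y) * ‖φ y‖ₑ) ^ 2 := by
          rw [lintegral_const_mul' _ _ (ENNReal.pow_ne_top hK)]
      _ ≤ K ^ 2 * ((∫⁻ y, schurWeight (d := d) y) ^ 2 * ∫⁻ y, ‖φ y‖ₑ ^ 2) := by
          gcongr
          exact lintegral_schur _ _ measurable_schurWeight hφ.enorm
      _ = _ := by rw [mul_pow, mul_assoc]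
  refine ⟨⟨?_, ?_⟩, hb⟩
  · exact (stronglyMeasurable_weylIntegrand ħ σ hφ).integral_prod_right'.aestronglyMeasurable
  · exact hb.trans_lt (ENNReal.mul_lt_top hKA.lt_top (Lp.eLpNorm_lt_top φ))

theorem memLp_weylFun {d : ℕ} (ħ : ℝ) (σ : 𝓢(Phase d, ℂ)) (φ : L2 d) :
    MemLp (weylFun ħ σ φ) 2 volume :=
  ((weylFun_bound ħ σ).choose_spec.2 φ).1

theorem weylFun_add {d : ℕ} (ħ : ℝ) (σ : 𝓢(Phase d, ℂ)) (φ ψ : L2 d) (x : Config d) :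
    weylFun ħ σ ⇑(φ + ψ) x = weylFun ħ σ φ x + weylFun ħ σ ψ x := by
  unfold weylFun
  rw [← integral_add (integrable_weylIntegrand ħ σ φ x) (integrable_weylIntegrand ħ σ ψ x)]
  refine integral_congr_ae ?_
  have h := Measure.quasiMeasurePreserving_fst (μ := (volume : Measure (Config d)))
    (ν := (volume : Measure (Config d))) |>.ae (Lp.coeFn_add φ ψ)
  filter_upwards [h] with p hp
  simp only [weylIntegrand]
  rw [hp, Pi.add_apply]
  ring

theorem weylFun_smul {d : ℕ} (ħ : ℝ) (σ : 𝓢(Phase d, ℂ)) (c : ℂ) (φ : L2 d) (x : Config d) :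
    weylFun ħ σ ⇑(c • φ) x = c * weylFun ħ σ φ x := by
  unfold weylFun
  rw [← integral_const_mul]
  refine integral_congr_ae ?_
  have h := Measure.quasiMeasurePreserving_fst (μ := (volume : Measure (Config d)))
    (ν := (volume : Measure (Config d))) |>.ae (Lp.coeFn_smul c φ)
  filter_upwards [h] with p hp
  simp only [weylIntegrand]
  rw [hp, Pi.smul_apply, smul_eq_mul]
  ring

/-- Weyl quantization of a Schwartz symbol `σ`, as a bounded operator of `L²(ℝᵈ)`: it sends
`φ` to (the class of) `x ↦ ∫ σ((x+y)/2, ξ) e^{i ξ·(x-y)/ħ} φ(y) dξ dy / (2πħ)^d`. -/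
def weylQuantization {d : ℕ} (ħ : ℝ) (σ : 𝓢(Phase d, ℂ)) : L2 d →L[ℂ] L2 d :=
  LinearMap.mkContinuousOfExistsBound
    { toFun := fun φ => (memLp_weylFun ħ σ φ).toLp (weylFun ħ σ φ)
      map_add' := fun φ ψ => by
        rw [← MemLp.toLp_add, MemLp.toLp_eq_toLp_iff]
        exact .of_forall fun x => weylFun_add ħ σ φ ψ x
      map_smul' := fun c φ => by
        rw [RingHom.id_apply, ← MemLp.toLp_const_smul, MemLp.toLp_eq_toLp_iff]
        exact .of_forall fun x => weylFun_smul ħ σ c φ x }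
    (by
      obtain ⟨K, hK, h⟩ := weylFun_bound ħ σ
      refine ⟨K.toReal, fun φ => ?_⟩
      change ‖MemLp.toLp (weylFun ħ σ φ) (memLp_weylFun ħ σ φ)‖ ≤ _
      rw [Lp.norm_toLp, Lp.norm_def, ← ENNReal.toReal_mul]
      exact ENNReal.toReal_mono (ENNReal.mul_ne_top hK (Lp.eLpNorm_ne_top φ)) (h φ).2)

theorem coeFn_weylQuantization {d : ℕ} (ħ : ℝ) (σ : 𝓢(Phase d, ℂ)) (φ : L2 d) :
    weylQuantization ħ σ φ =ᵐ[volume] weylFun ħ σ φ :=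
  MemLp.coeFn_toLp (memLp_weylFun ħ σ φ)

/-- `σ` is the Weyl symbol of the operator `V`. -/
def IsWeylSymbol {d : ℕ} (ħ : ℝ) (V : L2 d →L[ℂ] L2 d) (σ : 𝓢(Phase d, ℂ)) : Prop :=
  weylQuantization ħ σ = V

/-! ### Quantum side -/

/-- The Lie bracket `(1 / (i ħ)) (A B - B A)`. -/
def quantumBracket {d : ℕ} (ħ : ℝ) (A B : L2 d →L[ℂ] L2 d) : L2 d →L[ℂ] L2 d :=
  (Complex.I * (ħ : ℂ))⁻¹ • (A * B - B * A)

/-- The coefficient of `ε^m` in `Z^qu`, given the mould `F` and the homogeneous components `B_n`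
of the classical perturbation, whose Weyl quantizations are those of the quantum perturbation. -/
def quantumZ {d : ℕ} (ω : Fin d → ℝ) (F : Mould ℂ ℂ) (Bn : (Fin d → ℤ) → ℕ → 𝓢(Phase d, ℂ))
    (ħ : ℝ) (m : ℕ) : L2 d →L[ℂ] L2 d :=
  mouldExpansion (quantumBracket ħ) F (eigenvalue ω)
    (fun n i => weylQuantization ħ (Bn n i)) m

end WeylBNF

end

open WeylBNF

/-! Everything rests on the Weyl bracket, read on the Fourier side. A Schwartz symbol is a
superposition of plane waves with amplitude `phaseFourier d σ`, and its Weyl quantization is the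
superposition of Heisenberg translations with the same amplitude (`weylFun_superposition`). Two
translations compose to a third up to a phase governed by the symplectic form s of their frequencies
(`weylShift_weylShift`). Hence the bracket of two Weyl operators is again a Weyl operator. The
symbol of that operator, the Moyal bracket, comes from σ̂(u) τ̂(v) multiplied by 4π² sin(2π²ħ
s)/(2π²ħ) (`weylQuantization_moyalBracket`). The Poisson bracket has the same form with multiplier
4π² s (`poissonBracket_eq_phaseSynthesis`).

As ħ → 0⁺ the first multiplier tends to the second, with every derivative of the difference bounded
by a factor tending to 0 times a fixed power of 1 + ‖·‖. Tensor product, multiplication and Fourier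
synthesis are continuous on Schwartz spaces, so the Moyal bracket converges to the Poisson bracket,
even when both arguments vary with ħ (`tendsto_moyalBracket`). This joint form is what nested
brackets require.

At order ε^m, only words of length at most m over a finite alphabet contribute, and the mould
coefficients do not depend on ħ. The mould expansion written with Moyal brackets is therefore a
fixed finite sum. Quantization carries it to the quantum normal form, and it converges term by term
to the classical one. The symbol is unique because Weyl quantization is injective: the integral
kernel gives back the partial Fourier transform of the symbol (`fourier_symbol_eq_weylKernel`).

For the decomposition, existence comes from writing x and y linearly in z and w. Uniqueness comes
from the torus of rotations of the planes (xⱼ, yⱼ): it acts on degree n through the character n, and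
distinct characters are linearly independent. -/

noncomputable section
namespace WeylBNF

/-! ### Tensor products of Schwartz functions -/

section Tensor

variable {E F : Type*} [NormedAddCommGroup E] [NormedSpace ℝ E]
  [NormedAddCommGroup F] [NormedSpace ℝ F]

/-- The bound for the `(k, n)` seminorm of a tensor product. -/
def tensorBound (f : 𝓢(E, ℂ)) (g : 𝓢(F, ℂ)) (k n : ℕ) : ℝ :=
  ∑ i ∈ Finset.range (n + 1), (n.choose i : ℝ) *
    (SchwartzMap.seminorm ℝ k i f * SchwartzMap.seminorm ℝ 0 (n - i) g +
      SchwartzMap.seminorm ℝ 0 i f * SchwartzMap.seminorm ℝ k (n - i) g)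

theorem norm_iteratedFDeriv_comp_clm_le {G : Type*} [NormedAddCommGroup G] [NormedSpace ℝ G]
    (f : 𝓢(E, ℂ)) (L : G →L[ℝ] E) (hL : ‖L‖ ≤ 1) (i : ℕ) (x : G) :
    ‖iteratedFDeriv ℝ i (fun p => f (L p)) x‖ ≤ ‖iteratedFDeriv ℝ i f (L x)‖ := by
  have h := L.iteratedFDeriv_comp_right (f := f) (f.smooth ⊤) x (i := i) (mod_cast le_top)
  change ‖iteratedFDeriv ℝ i (f ∘ L) x‖ ≤ _
  rw [h]
  refine (ContinuousMultilinearMap.norm_compContinuousLinearMap_le _ _).trans ?_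
  refine mul_le_of_le_one_right (norm_nonneg _) ?_
  simp only [Finset.prod_const, Finset.card_univ, Fintype.card_fin]
  exact pow_le_one₀ (norm_nonneg _) hL

/-- The norm of a product space is the maximum, so ‖p‖^k ≤ ‖p.1‖^k + ‖p.2‖^k. In each Leibniz term
the weight then falls on one factor only. The bound is explicit in the seminorms of `f` and `g` so
that it can be passed to the limit. -/
theorem pow_norm_mul_iteratedFDeriv_tensor_le (f : 𝓢(E, ℂ)) (g : 𝓢(F, ℂ)) (k n : ℕ) (p : E × F) :
    ‖p‖ ^ k * ‖iteratedFDeriv ℝ n (fun p : E × F => f p.1 * g p.2) p‖ ≤ tensorBound f g k n := by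
  have hf : ContDiff ℝ ((⊤ : ℕ∞) : WithTop ℕ∞) fun p : E × F => f p.1 :=
    (f.smooth ⊤).comp contDiff_fst
  have hg : ContDiff ℝ ((⊤ : ℕ∞) : WithTop ℕ∞) fun p : E × F => g p.2 :=
    (g.smooth ⊤).comp contDiff_snd
  have h := norm_iteratedFDeriv_mul_le hf hg p (n := n) (mod_cast le_top)
  have hk : ‖p‖ ^ k ≤ ‖p.1‖ ^ k + ‖p.2‖ ^ k := by
    rcases le_total ‖p.1‖ ‖p.2‖ with h | h
    · rw [Prod.norm_def, max_eq_right h]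
      exact le_add_of_nonneg_left (by positivity)
    · rw [Prod.norm_def, max_eq_left h]
      exact le_add_of_nonneg_right (by positivity)
  calc _ ≤ (‖p.1‖ ^ k + ‖p.2‖ ^ k) * ∑ i ∈ Finset.range (n + 1), (n.choose i : ℝ) *
        ‖iteratedFDeriv ℝ i (fun p : E × F => f p.1) p‖ *
        ‖iteratedFDeriv ℝ (n - i) (fun p : E × F => g p.2) p‖ := by gcongr
    _ ≤ (‖p.1‖ ^ k + ‖p.2‖ ^ k) * ∑ i ∈ Finset.range (n + 1), (n.choose i : ℝ) *
        ‖iteratedFDeriv ℝ i f p.1‖ * ‖iteratedFDeriv ℝ (n - i) g p.2‖ := by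
        gcongr with i hi
        · exact norm_iteratedFDeriv_comp_clm_le f (ContinuousLinearMap.fst ℝ E F)
            (ContinuousLinearMap.norm_fst_le ..) i p
        · exact norm_iteratedFDeriv_comp_clm_le g (ContinuousLinearMap.snd ℝ E F)
            (ContinuousLinearMap.norm_snd_le ..) (n - i) p
    _ ≤ _ := by
        rw [Finset.mul_sum, tensorBound]
        refine Finset.sum_le_sum fun i _ => ?_
        have a1 := SchwartzMap.le_seminorm ℝ k i f p.1
        have a2 := SchwartzMap.norm_iteratedFDeriv_le_seminorm ℝ f i p.1
        have b1 := SchwartzMap.le_seminorm ℝ k (n - i) g p.2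
        have b2 := SchwartzMap.norm_iteratedFDeriv_le_seminorm ℝ g (n - i) p.2
        calc _ = (n.choose i : ℝ) *
              ((‖p.1‖ ^ k * ‖iteratedFDeriv ℝ i f p.1‖) * ‖iteratedFDeriv ℝ (n - i) g p.2‖ +
              ‖iteratedFDeriv ℝ i f p.1‖ * (‖p.2‖ ^ k * ‖iteratedFDeriv ℝ (n - i) g p.2‖)) := by
              ring
          _ ≤ _ := by gcongr

/-- The tensor product `(x, y) ↦ f x * g y` of two Schwartz functions. -/
def schwartzTensor (f : 𝓢(E, ℂ)) (g : 𝓢(F, ℂ)) : 𝓢(E × F, ℂ) where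
  toFun p := f p.1 * g p.2
  smooth' := ((f.smooth ⊤).comp contDiff_fst).mul ((g.smooth ⊤).comp contDiff_snd)
  decay' k n := ⟨_, pow_norm_mul_iteratedFDeriv_tensor_le f g k n⟩

@[simp]
theorem schwartzTensor_apply (f : 𝓢(E, ℂ)) (g : 𝓢(F, ℂ)) (p : E × F) :
    schwartzTensor f g p = f p.1 * g p.2 := rfl

theorem tensorBound_nonneg (f : 𝓢(E, ℂ)) (g : 𝓢(F, ℂ)) (k n : ℕ) : 0 ≤ tensorBound f g k n :=
  Finset.sum_nonneg fun _ _ => by positivity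

theorem seminorm_schwartzTensor_le (f : 𝓢(E, ℂ)) (g : 𝓢(F, ℂ)) (k n : ℕ) :
    SchwartzMap.seminorm ℝ k n (schwartzTensor f g) ≤ tensorBound f g k n :=
  SchwartzMap.seminorm_le_bound ℝ k n _ (tensorBound_nonneg f g k n)
    (pow_norm_mul_iteratedFDeriv_tensor_le f g k n)

theorem continuous_schwartzSeminorm (k n : ℕ) :
    Continuous (SchwartzMap.seminorm ℝ k n : Seminorm ℝ 𝓢(E, ℂ)) :=
  (schwartz_withSeminorms ℝ E ℂ).continuous_seminorm (k, n)

theorem tendsto_schwartz_iff {ι : Type*} {l : Filter ι} {f : ι → 𝓢(E, ℂ)} {f₀ : 𝓢(E, ℂ)} :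
    Tendsto f l (𝓝 f₀) ↔
      ∀ k n, Tendsto (fun t => SchwartzMap.seminorm ℝ k n (f t - f₀)) l (𝓝 0) := by
  constructor
  · intro h k n
    have h1 : Tendsto (fun t => f t - f₀) l (𝓝 0) := by
      simpa using h.sub_const f₀
    have h2 := ((continuous_schwartzSeminorm k n).tendsto (0 : 𝓢(E, ℂ))).comp h1
    rwa [map_zero] at h2
  · intro h
    rw [(schwartz_withSeminorms ℝ E ℂ).tendsto_nhds]
    intro i ε hε
    exact (h i.1 i.2).eventually (gt_mem_nhds hε)

theorem tendsto_tensorBound {ι : Type*} {l : Filter ι} {f : ι → 𝓢(E, ℂ)} {f₀ : 𝓢(E, ℂ)}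
    {g : ι → 𝓢(F, ℂ)} {g₀ : 𝓢(F, ℂ)} (hf : Tendsto f l (𝓝 f₀)) (hg : Tendsto g l (𝓝 g₀))
    (k n : ℕ) :
    Tendsto (fun t => tensorBound (f t) (g t) k n) l (𝓝 (tensorBound f₀ g₀ k n)) := by
  have hf' : ∀ k n, Tendsto (fun t => SchwartzMap.seminorm ℝ k n (f t)) l
      (𝓝 (SchwartzMap.seminorm ℝ k n f₀)) := fun k n =>
    ((continuous_schwartzSeminorm k n).tendsto f₀).comp hf
  have hg' : ∀ k n, Tendsto (fun t => SchwartzMap.seminorm ℝ k n (g t)) l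
      (𝓝 (SchwartzMap.seminorm ℝ k n g₀)) := fun k n =>
    ((continuous_schwartzSeminorm k n).tendsto g₀).comp hg
  exact tendsto_finsetSum _ fun i _ =>
    (((hf' _ _).mul (hg' _ _)).add ((hf' _ _).mul (hg' _ _))).const_mul _

/-- Bilinear telescoping: the difference is (f t - f₀) ⊗ g t + f₀ ⊗ (g t - g₀), and `tensorBound` is
continuous and vanishes as soon as one argument is 0. -/
theorem Tendsto.schwartzTensor {ι : Type*} {l : Filter ι} {f : ι → 𝓢(E, ℂ)} {f₀ : 𝓢(E, ℂ)}
    {g : ι → 𝓢(F, ℂ)} {g₀ : 𝓢(F, ℂ)} (hf : Tendsto f l (𝓝 f₀)) (hg : Tendsto g l (𝓝 g₀)) :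
    Tendsto (fun t => schwartzTensor (f t) (g t)) l (𝓝 (schwartzTensor f₀ g₀)) := by
  rw [tendsto_schwartz_iff]
  intro k n
  have e : ∀ t, WeylBNF.schwartzTensor (f t) (g t) - WeylBNF.schwartzTensor f₀ g₀ =
      WeylBNF.schwartzTensor (f t - f₀) (g t) + WeylBNF.schwartzTensor f₀ (g t - g₀) := by
    intro t; ext p; simp; ring
  have h1 : Tendsto (fun t => f t - f₀) l (𝓝 0) := by simpa using hf.sub_const f₀
  have h2 : Tendsto (fun t => g t - g₀) l (𝓝 0) := by simpa using hg.sub_const g₀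
  have h := (tendsto_tensorBound h1 hg k n).add
    (tendsto_tensorBound (tendsto_const_nhds (x := f₀)) h2 k n)
  have z : tensorBound (0 : 𝓢(E, ℂ)) g₀ k n + tensorBound f₀ (0 : 𝓢(F, ℂ)) k n = 0 := by
    simp [tensorBound]
  rw [z] at h
  refine squeeze_zero (fun t => apply_nonneg _ _) (fun t => ?_) h
  rw [e]
  exact (map_add_le_add _ _ _).trans
    (add_le_add (seminorm_schwartzTensor_le _ _ _ _) (seminorm_schwartzTensor_le _ _ _ _))

end Tensor

/-! ### Convergence of multiplication operators -/

section Multiplier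

variable {E : Type*} [NormedAddCommGroup E] [NormedSpace ℝ E]

/-- A continuous function of `f` that controls the `(k, n)` seminorm of `g • f` when the derivatives
of `g` up to order `n` are bounded by `(1 + ‖x‖) ^ N`. -/
def multiplierBound (f : 𝓢(E, ℂ)) (N k n : ℕ) : ℝ :=
  ∑ i ∈ Finset.range (n + 1), (n.choose i : ℝ) * (2 ^ N *
    (SchwartzMap.seminorm ℝ k (n - i) f + SchwartzMap.seminorm ℝ (k + N) (n - i) f))

theorem continuous_multiplierBound (N k n : ℕ) :
    Continuous fun f : 𝓢(E, ℂ) => multiplierBound f N k n :=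
  continuous_finsetSum _ fun _ _ => continuous_const.mul (continuous_const.mul
    ((continuous_schwartzSeminorm _ _).add (continuous_schwartzSeminorm _ _)))

theorem one_add_pow_le {r : ℝ} (hr : 0 ≤ r) (N : ℕ) : (1 + r) ^ N ≤ 2 ^ N * (1 + r ^ N) := by
  rcases le_total r 1 with h | h
  · calc (1 + r) ^ N ≤ 2 ^ N := by gcongr; linarith
      _ ≤ _ := le_mul_of_one_le_right (by positivity) (by simp [hr])
  · calc (1 + r) ^ N ≤ (2 * r) ^ N := by gcongr; linarith
      _ = 2 ^ N * r ^ N := mul_pow ..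
      _ ≤ _ := by gcongr; linarith

/-- In the Leibniz formula the polynomial growth of `g` is absorbed by raising the decay exponent
from k to k + N. The constant `C` factors out, so a small multiplier gives a small seminorm. -/
theorem seminorm_smulLeftCLM_le {g : E → ℝ} (hg : g.HasTemperateGrowth) {C : ℝ} (hC : 0 ≤ C)
    {N n : ℕ} (hb : ∀ i ≤ n, ∀ x, ‖iteratedFDeriv ℝ i g x‖ ≤ C * (1 + ‖x‖) ^ N)
    (f : 𝓢(E, ℂ)) (k : ℕ) :
    SchwartzMap.seminorm ℝ k n (SchwartzMap.smulLeftCLM ℂ g f) ≤ C * multiplierBound f N k n := by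
  refine SchwartzMap.seminorm_le_bound ℝ k n _
    (mul_nonneg hC (Finset.sum_nonneg fun _ _ => by positivity)) fun x => ?_
  rw [SchwartzMap.smulLeftCLM_apply hg]
  have h := norm_iteratedFDeriv_smul_le hg.1 (f.smooth ⊤) x (n := n) (mod_cast le_top)
  calc _ ≤ ‖x‖ ^ k * ∑ i ∈ Finset.range (n + 1), (n.choose i : ℝ) *
        ‖iteratedFDeriv ℝ i g x‖ * ‖iteratedFDeriv ℝ (n - i) f x‖ := by gcongr
    _ ≤ ‖x‖ ^ k * ∑ i ∈ Finset.range (n + 1), (n.choose i : ℝ) *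
        (C * (2 ^ N * (1 + ‖x‖ ^ N))) * ‖iteratedFDeriv ℝ (n - i) f x‖ := by
        gcongr with i hi
        refine (hb i (by simpa [Nat.lt_succ_iff] using hi) x).trans ?_
        gcongr
        exact one_add_pow_le (norm_nonneg _) _
    _ ≤ _ := by
        rw [multiplierBound, Finset.mul_sum, Finset.mul_sum]
        refine Finset.sum_le_sum fun i _ => ?_
        have a1 := SchwartzMap.le_seminorm ℝ k (n - i) f x
        have a2 := SchwartzMap.le_seminorm ℝ (k + N) (n - i) f x
        calc _ = C * ((n.choose i : ℝ) * (2 ^ N * (‖x‖ ^ k * ‖iteratedFDeriv ℝ (n - i) f x‖ +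
              ‖x‖ ^ (k + N) * ‖iteratedFDeriv ℝ (n - i) f x‖))) := by ring
          _ ≤ _ := by gcongr

/-- If multipliers converge with polynomial control of all derivatives, and if the functions converge
in the Schwartz space, then so do the products. -/
theorem tendsto_smulLeftCLM {ι : Type*} {l : Filter ι} {g : ι → E → ℝ} {g₀ : E → ℝ}
    (hg : ∀ᶠ t in l, (g t).HasTemperateGrowth) (hg₀ : g₀.HasTemperateGrowth)
    (hb : ∀ n : ℕ, ∃ (N : ℕ) (C : ι → ℝ), Tendsto C l (𝓝 0) ∧ ∀ᶠ t in l, 0 ≤ C t ∧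
      ∀ i ≤ n, ∀ x, ‖iteratedFDeriv ℝ i (g t - g₀) x‖ ≤ C t * (1 + ‖x‖) ^ N)
    {f : ι → 𝓢(E, ℂ)} {f₀ : 𝓢(E, ℂ)} (hf : Tendsto f l (𝓝 f₀)) :
    Tendsto (fun t => SchwartzMap.smulLeftCLM ℂ (g t) (f t)) l
      (𝓝 (SchwartzMap.smulLeftCLM ℂ g₀ f₀)) := by
  have h0 := ((SchwartzMap.smulLeftCLM ℂ g₀).continuous.tendsto f₀).comp hf
  -- Split g t · f t as (g t - g₀) f t + g₀ f t. A fixed multiplier is continuous, so only the first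
  -- term needs the estimate: there C t → 0 multiplies a convergent quantity.
  have h1 : Tendsto (fun t => SchwartzMap.smulLeftCLM ℂ (g t - g₀) (f t)) l (𝓝 0) := by
    rw [tendsto_schwartz_iff]
    intro k n
    obtain ⟨N, C, hC0, hb⟩ := hb n
    have h := hC0.mul (((continuous_multiplierBound N k n).tendsto f₀).comp hf)
    rw [zero_mul] at h
    refine squeeze_zero' (.of_forall fun t => apply_nonneg _ _) ?_ h
    filter_upwards [hg, hb] with t hgt hbt
    rw [sub_zero]
    exact seminorm_smulLeftCLM_le (hgt.sub hg₀) hbt.1 hbt.2 (f t) k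
  have h2 := h1.add h0
  rw [zero_add] at h2
  refine h2.congr' ?_
  filter_upwards [hg] with t hgt
  rw [SchwartzMap.smulLeftCLM_sub hgt hg₀]
  simp

end Multiplier

/-! ### The multiplier `sin (θ s) / θ` -/

section Sine

/-- The function `t ↦ sin (θ t) / θ - t`. -/
def sineDefect (θ : ℝ) (t : ℝ) : ℝ := Real.sin (θ * t) / θ - t

theorem contDiff_sineDefect (θ : ℝ) {n : WithTop ℕ∞} : ContDiff ℝ n (sineDefect θ) := by
  unfold sineDefect
  exact ((Real.contDiff_sin.comp (contDiff_const.mul contDiff_id)).div_const _).sub contDiff_id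

theorem deriv_sineDefect {θ : ℝ} (hθ : θ ≠ 0) :
    deriv (sineDefect θ) = fun t => Real.cos (θ * t) - 1 := by
  funext t
  have h1 : HasDerivAt (fun t : ℝ => θ * t) θ t := by
    simpa using (hasDerivAt_id t).const_mul θ
  have h := ((h1.sin).div_const θ).sub (hasDerivAt_id t)
  rw [show sineDefect θ = (fun t => Real.sin (θ * t) / θ) - id from rfl, h.deriv]
  field_simp

/-- A quadratic bound valid on the whole line is enough: after rescaling, |sin(θt)/θ - t| ≤ θ t²,
which already carries the factor θ that tends to 0. -/
theorem abs_sin_sub_self_le (x : ℝ) : |Real.sin x - x| ≤ x ^ 2 := by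
  have key : ∀ y : ℝ, 0 ≤ y → |Real.sin y - y| ≤ y ^ 2 := fun y hy => by
    rw [abs_of_nonpos (by linarith [Real.sin_le hy])]
    rcases hy.eq_or_lt with rfl | hy
    · simp
    -- Up to 1 the cubic lower bound for sine suffices, as y³ ≤ y². Up to π sine is nonnegative and
    -- y ≤ y². Beyond π, y + 1 ≤ y².
    rcases le_or_gt y 1 with h1 | h1
    · nlinarith [Real.sin_gt_sub_cube hy, mul_nonneg (sq_nonneg y) (sub_nonneg.2 h1)]
    · rcases le_or_gt y Real.pi with h2 | h2
      · nlinarith [Real.sin_nonneg_of_nonneg_of_le_pi hy.le h2]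
      · nlinarith [Real.neg_one_le_sin y, Real.pi_gt_three]
  rcases le_total 0 x with h | h
  · exact key x h
  · have := key (-x) (by linarith)
    rwa [Real.sin_neg, ← abs_neg, neg_sq, neg_sub, sub_neg_eq_add, neg_add_eq_sub, abs_sub_comm,
      abs_sub_comm] at this

/-- Every order gains a factor θ: order 0 is at most θt², order 1 is cos(θt) - 1, and order m + 2 is
-θ^(m+1) times an m-th derivative of sine. The factors (1 + θ)^n and (1 + ‖t‖)² only serve to make
one bound fit all orders. -/
theorem norm_iteratedFDeriv_sineDefect_le {θ : ℝ} (hθ : 0 < θ) (n : ℕ) (t : ℝ) :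
    ‖iteratedFDeriv ℝ n (sineDefect θ) t‖ ≤ θ * (1 + θ) ^ n * (1 + ‖t‖) ^ 2 := by
  rw [norm_iteratedFDeriv_eq_norm_iteratedDeriv]
  have ht : t ^ 2 ≤ (1 + ‖t‖) ^ 2 := by
    rw [Real.norm_eq_abs, ← sq_abs t]; gcongr; linarith
  match n with
  | 0 =>
    rw [iteratedDeriv_zero, sineDefect, Real.norm_eq_abs, pow_zero, mul_one]
    have h := abs_sin_sub_self_le (θ * t)
    have e : Real.sin (θ * t) / θ - t = (Real.sin (θ * t) - θ * t) / θ := by field_simp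
    rw [e, abs_div, abs_of_pos hθ, div_le_iff₀ hθ]
    nlinarith [sq_nonneg θ]
  | 1 =>
    rw [iteratedDeriv_one, deriv_sineDefect hθ.ne', Real.norm_eq_abs, pow_one]
    have h1 := Real.one_sub_sq_div_two_le_cos (x := θ * t)
    have h2 := Real.cos_le_one (θ * t)
    rw [abs_of_nonpos (by linarith)]
    have : (θ * t) ^ 2 ≤ θ * (1 + θ) * (1 + ‖t‖) ^ 2 := by
      rw [mul_pow]; gcongr; nlinarith
    nlinarith [sq_nonneg (θ * t)]
  | m + 2 =>
    have e : deriv (fun t : ℝ => Real.cos (θ * t) - 1) = fun t => (-θ) * Real.sin (θ * t) := by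
      funext t
      have h1 : HasDerivAt (fun t : ℝ => θ * t) θ t := by
        simpa using (hasDerivAt_id t).const_mul θ
      rw [(h1.cos.sub_const 1).deriv]; ring
    rw [iteratedDeriv_succ', iteratedDeriv_succ', deriv_sineDefect hθ.ne', e,
      iteratedDeriv_const_mul_field, iteratedDeriv_comp_const_mul Real.contDiff_sin]
    have hs := Real.abs_iteratedDeriv_sin_le_one m (θ * t)
    simp only [norm_mul, norm_neg, Real.norm_eq_abs, abs_pow, abs_of_pos hθ]
    calc θ * (θ ^ m * |iteratedDeriv m Real.sin (θ * t)|) ≤ θ * ((1 + θ) ^ m * 1) := by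
          gcongr; linarith
      _ ≤ θ * (1 + θ) ^ (m + 2) * 1 := by
          rw [mul_one, mul_one]
          gcongr
          · linarith
          · omega
      _ ≤ _ := by
          gcongr
          exact one_le_pow₀ (by simp)

variable {E : Type*} [NormedAddCommGroup E] [NormedSpace ℝ E]

/-- A Faà di Bruno estimate. What matters is that N and K are chosen before θ, so that the bound
tends to 0 with θ. -/
theorem exists_norm_iteratedFDeriv_sineDefect_comp_le {s : E → ℝ} (hs : s.HasTemperateGrowth)
    (n : ℕ) : ∃ (N : ℕ) (K : ℝ), 0 ≤ K ∧ ∀ θ > 0, ∀ i ≤ n, ∀ x,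
      ‖iteratedFDeriv ℝ i (sineDefect θ ∘ s) x‖ ≤ θ * (1 + θ) ^ n * K * (1 + ‖x‖) ^ N := by
  obtain ⟨k, C, hC, h⟩ := hs.norm_iteratedFDeriv_le_uniform n
  -- Put D = (1 + C)(1 + ‖x‖)^k. The quadratic growth of the defect at s x contributes D², the inner
  -- derivatives at most D^n. Using 1 + C instead of C makes D ≥ 1, so its powers are monotone.
  refine ⟨k * 2 + k * n, n.factorial * (1 + C) ^ 2 * (1 + C) ^ n, by positivity,
    fun θ hθ i hi x => ?_⟩
  have h1 : (1 : ℝ) ≤ (1 + ‖x‖) ^ k := one_le_pow₀ (by simp)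
  have hD : 1 ≤ (1 + C) * (1 + ‖x‖) ^ k := one_le_mul_of_one_le_of_one_le (by simp [hC]) h1
  have hg : ∀ j ≤ i, ‖iteratedFDeriv ℝ j (sineDefect θ) (s x)‖ ≤
      θ * (1 + θ) ^ n * ((1 + C) * (1 + ‖x‖) ^ k) ^ 2 := fun j hj => by
    refine (norm_iteratedFDeriv_sineDefect_le hθ j (s x)).trans ?_
    have h0 := h 0 (Nat.zero_le _) x
    rw [norm_iteratedFDeriv_zero] at h0
    gcongr
    · linarith
    · omega
    · nlinarith
  have hf : ∀ j, 1 ≤ j → j ≤ i →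
      ‖iteratedFDeriv ℝ j s x‖ ≤ ((1 + C) * (1 + ‖x‖) ^ k) ^ j := fun j hj hj' =>
    calc _ ≤ C * (1 + ‖x‖) ^ k := h j (hj'.trans hi) x
      _ ≤ (1 + C) * (1 + ‖x‖) ^ k := by gcongr; simp
      _ ≤ _ := le_self_pow₀ hD (by omega)
  calc _ ≤ i.factorial * (θ * (1 + θ) ^ n * ((1 + C) * (1 + ‖x‖) ^ k) ^ 2) *
        ((1 + C) * (1 + ‖x‖) ^ k) ^ i :=
        norm_iteratedFDeriv_comp_le (contDiff_sineDefect θ (n := (⊤ : ℕ∞))) hs.1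
          (mod_cast le_top) x hg hf
    _ ≤ n.factorial * (θ * (1 + θ) ^ n * ((1 + C) * (1 + ‖x‖) ^ k) ^ 2) *
        ((1 + C) * (1 + ‖x‖) ^ k) ^ n := by
        gcongr
    _ = _ := by rw [mul_pow, mul_pow, pow_add, pow_mul, pow_mul]; ring

theorem hasTemperateGrowth_sineDefect_comp {s : E → ℝ} (hs : s.HasTemperateGrowth) {θ : ℝ}
    (hθ : 0 < θ) : (sineDefect θ ∘ s).HasTemperateGrowth := by
  refine ⟨(contDiff_sineDefect θ).comp hs.1, fun n => ?_⟩
  obtain ⟨N, K, -, h⟩ := exists_norm_iteratedFDeriv_sineDefect_comp_le hs n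
  exact ⟨N, _, h θ hθ n le_rfl⟩

theorem hasTemperateGrowth_sin_div {s : E → ℝ} (hs : s.HasTemperateGrowth) {θ : ℝ}
    (hθ : 0 < θ) : (fun x => Real.sin (θ * s x) / θ).HasTemperateGrowth := by
  have h := (hasTemperateGrowth_sineDefect_comp hs hθ).add hs
  convert h using 1
  funext x
  simp [sineDefect]

end Sine

/-! ### Fourier analysis on phase space -/

section PhaseFourier

open FourierTransform LineDeriv

variable {d : ℕ}

/-- The Euclidean scalar product of `ℝᵈ × ℝᵈ`. -/
def phaseDot (u X : Phase d) : ℝ := inner ℝ u.1 X.1 + inner ℝ u.2 X.2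

/-- The plane wave `X ↦ e^{2πi ⟨u, X⟩}`. -/
def phaseWave (u X : Phase d) : ℂ := Complex.exp ((2 * Real.pi * phaseDot u X : ℝ) * Complex.I)

theorem norm_phaseWave (u X : Phase d) : ‖phaseWave u X‖ = 1 :=
  Complex.norm_exp_ofReal_mul_I _

theorem phaseDot_add_left (u v X : Phase d) :
    phaseDot (u + v) X = phaseDot u X + phaseDot v X := by
  simp only [phaseDot, Prod.fst_add, Prod.snd_add, inner_add_left]; ring

theorem phaseWave_add_left (u v X : Phase d) :
    phaseWave (u + v) X = phaseWave u X * phaseWave v X := by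
  rw [phaseWave, phaseWave, phaseWave, ← Complex.exp_add, phaseDot_add_left]
  push_cast; ring_nf

/-- Phase space with its Euclidean norm. -/
abbrev PhaseL2 (d : ℕ) : Type := WithLp 2 (Config d × Config d)

/-- The identification of the Euclidean phase space with the product. -/
def phaseEquiv (d : ℕ) : PhaseL2 d ≃L[ℝ] Phase d :=
  WithLp.prodContinuousLinearEquiv 2 ℝ (Config d) (Config d)

theorem measurePreserving_phaseEquiv : MeasurePreserving (phaseEquiv d) :=
  WithLp.volume_preserving_ofLp (Config d) (Config d)

theorem measurableEmbedding_clEquiv {E F : Type*} [NormedAddCommGroup E] [NormedSpace ℝ E]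
    [NormedAddCommGroup F] [NormedSpace ℝ F] [MeasurableSpace E] [BorelSpace E]
    [MeasurableSpace F] [BorelSpace F] (e : E ≃L[ℝ] F) : MeasurableEmbedding e :=
  e.toHomeomorph.measurableEmbedding

theorem inner_phaseEquiv_symm (u X : Phase d) :
    inner ℝ ((phaseEquiv d).symm u) ((phaseEquiv d).symm X) = phaseDot u X := by
  rw [WithLp.prod_inner_apply]; rfl

/-- The Fourier transform `u ↦ ∫ σ(X) e^{-2πi ⟨u, X⟩} dX` on phase space. -/
def phaseFourier (d : ℕ) : 𝓢(Phase d, ℂ) →L[ℂ] 𝓢(Phase d, ℂ) :=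
  (SchwartzMap.compCLMOfContinuousLinearEquiv ℂ (phaseEquiv d).symm).comp
    ((fourierCLM ℂ 𝓢(PhaseL2 d, ℂ)).comp
      (SchwartzMap.compCLMOfContinuousLinearEquiv ℂ (phaseEquiv d)))

/-- `Phase d` carries the maximum norm, so inversion is applied on the Euclidean `PhaseL2 d` and
transported along the measure-preserving identification. -/
theorem phaseFourier_inversion (σ : 𝓢(Phase d, ℂ)) (X : Phase d) :
    σ X = ∫ u, phaseFourier d σ u * phaseWave u X := by
  set τ : 𝓢(PhaseL2 d, ℂ) := SchwartzMap.compCLMOfContinuousLinearEquiv ℂ (phaseEquiv d) σ with hτ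
  have h1 : σ X = (𝓕⁻ (𝓕 τ)) ((phaseEquiv d).symm X) := by
    rw [FourierTransform.fourierInv_fourier_eq]; simp [hτ]
  rw [h1, SchwartzMap.fourierInv_coe, Real.fourierInv_eq',
    ← (measurePreserving_phaseEquiv (d := d)).integral_comp (measurableEmbedding_clEquiv _)]
  refine integral_congr_ae (.of_forall fun v => ?_)
  have h2 := inner_phaseEquiv_symm (phaseEquiv d v) X
  rw [ContinuousLinearEquiv.symm_apply_apply] at h2
  simp only [h2, smul_eq_mul, phaseWave]
  rw [mul_comm]
  congr 1

theorem phaseFourier_lineDerivOp (σ : 𝓢(Phase d, ℂ)) (m u : Phase d) :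
    phaseFourier d (∂_{m} σ) u =
      2 * Real.pi * Complex.I * phaseDot u m * phaseFourier d σ u := by
  have h1 : SchwartzMap.compCLMOfContinuousLinearEquiv ℂ (phaseEquiv d) (∂_{m} σ) =
      ∂_{(phaseEquiv d).symm m}
        (SchwartzMap.compCLMOfContinuousLinearEquiv ℂ (phaseEquiv d) σ) := by
    rw [SchwartzMap.lineDerivOp_compCLMOfContinuousLinearEquiv,
      ContinuousLinearEquiv.apply_symm_apply]
  simp only [phaseFourier, ContinuousLinearMap.comp_apply, h1, fourierCLM_apply,
    SchwartzMap.fourier_lineDerivOp_eq, SchwartzMap.compCLMOfContinuousLinearEquiv_apply,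
    Function.comp_apply, smul_apply]
  rw [SchwartzMap.smulLeftCLM_apply_apply (by fun_prop), inner_phaseEquiv_symm]
  simp only [smul_eq_mul, Complex.real_smul]
  ring

/-- The product of two phase spaces with its Euclidean norm, identified with the product. -/
def phasePairEquiv (d : ℕ) : WithLp 2 (PhaseL2 d × PhaseL2 d) ≃L[ℝ] Phase d × Phase d :=
  (WithLp.prodContinuousLinearEquiv 2 ℝ (PhaseL2 d) (PhaseL2 d)).trans
    ((phaseEquiv d).prodCongr (phaseEquiv d))

theorem measurePreserving_phasePairEquiv : MeasurePreserving (phasePairEquiv d) :=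
  (measurePreserving_phaseEquiv.prod measurePreserving_phaseEquiv).comp
    (WithLp.volume_preserving_ofLp (PhaseL2 d) (PhaseL2 d))

theorem inner_phasePairEquiv_symm (p q : Phase d × Phase d) :
    inner ℝ ((phasePairEquiv d).symm p) ((phasePairEquiv d).symm q) =
      phaseDot p.1 q.1 + phaseDot p.2 q.2 := by
  rw [WithLp.prod_inner_apply, ← inner_phaseEquiv_symm, ← inner_phaseEquiv_symm]; rfl

theorem antilipschitzWith_diag (E : Type*) [PseudoEMetricSpace E] :
    AntilipschitzWith 1 fun x : E => (x, x) := fun x y => by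
  simp [Prod.edist_eq]

/-- The map `X ↦ (X, X)`, with values in the Euclidean product. -/
def phaseDiag (d : ℕ) : Phase d →L[ℝ] WithLp 2 (PhaseL2 d × PhaseL2 d) :=
  (phasePairEquiv d).symm.toContinuousLinearMap.comp
    ((ContinuousLinearMap.id ℝ (Phase d)).prod (ContinuousLinearMap.id ℝ (Phase d)))

/-- The operator `H ↦ (X ↦ ∫ H(u, v) e^{2πi ⟨u + v, X⟩} du dv)`. -/
def phaseSynthesis (d : ℕ) : 𝓢(Phase d × Phase d, ℂ) →L[ℂ] 𝓢(Phase d, ℂ) :=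
  (SchwartzMap.compCLMOfAntilipschitz ℂ (phaseDiag d).hasTemperateGrowth
    ((phasePairEquiv d).symm.antilipschitz.comp (antilipschitzWith_diag (Phase d)))).comp
    ((fourierInvCLM ℂ 𝓢(WithLp 2 (PhaseL2 d × PhaseL2 d), ℂ)).comp
      (SchwartzMap.compCLMOfContinuousLinearEquiv ℂ (phasePairEquiv d)))

/-- Pairing (u, v) with (X, X) gives ⟨u + v, X⟩, so the synthesis is an inverse Fourier transform on
the doubled space restricted to the diagonal. -/
theorem phaseSynthesis_apply (H : 𝓢(Phase d × Phase d, ℂ)) (X : Phase d) :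
    phaseSynthesis d H X = ∫ p : Phase d × Phase d, H p * phaseWave (p.1 + p.2) X := by
  have h1 : phaseSynthesis d H X = (𝓕⁻ (SchwartzMap.compCLMOfContinuousLinearEquiv ℂ
      (phasePairEquiv d) H)) ((phasePairEquiv d).symm (X, X)) := rfl
  rw [h1, SchwartzMap.fourierInv_coe, Real.fourierInv_eq',
    ← (measurePreserving_phasePairEquiv (d := d)).integral_comp (measurableEmbedding_clEquiv _)]
  refine integral_congr_ae (.of_forall fun v => ?_)
  have h2 := inner_phasePairEquiv_symm (phasePairEquiv d v) (X, X)
  rw [ContinuousLinearEquiv.symm_apply_apply] at h2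
  simp only [h2, smul_eq_mul, phaseWave, phaseDot_add_left]
  rw [mul_comm]
  rfl

/-- The synthesis operator sends `σ̂ ⊗ τ̂` to the product `σ τ`. -/
theorem phaseSynthesis_tensor (σ τ : 𝓢(Phase d, ℂ)) (X : Phase d) :
    phaseSynthesis d (schwartzTensor (phaseFourier d σ) (phaseFourier d τ)) X = σ X * τ X := by
  rw [phaseSynthesis_apply, phaseFourier_inversion σ X, phaseFourier_inversion τ X,
    ← integral_prod_mul, Measure.volume_eq_prod]
  refine integral_congr_ae (.of_forall fun p => ?_)
  simp only [schwartzTensor_apply, phaseWave_add_left]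
  ring

end PhaseFourier

/-! ### Weyl quantization as a superposition of Heisenberg translations -/

section Heisenberg

open FourierTransform

variable {d : ℕ}

/-- The Heisenberg translation
`φ ↦ (x ↦ e^{2πi (⟨a, x⟩ + πħ ⟨a, b⟩)} φ(x + 2πħ b))`, where `u = (a, b)`. It is the Weyl quantization
of the plane wave with frequency `u`. -/
def weylShift (ħ : ℝ) (u : Phase d) (φ : Config d → ℂ) (x : Config d) : ℂ :=
  Complex.exp ((2 * Real.pi * (inner ℝ u.1 x + Real.pi * ħ * inner ℝ u.1 u.2) : ℝ) * Complex.I) *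
    φ (x + (2 * Real.pi * ħ) • u.2)

/-- Bounded continuous integrable functions with integrable Fourier transform. -/
structure IsTame (φ : Config d → ℂ) : Prop where
  continuous : Continuous φ
  bounded : ∃ C, ∀ x, ‖φ x‖ ≤ C
  integrable : Integrable φ
  integrable_fourier : Integrable (𝓕 φ)

theorem isTame_schwartz (φ : 𝓢(Config d, ℂ)) : IsTame φ where
  continuous := φ.continuous
  bounded := ⟨_, SchwartzMap.norm_le_seminorm ℝ φ⟩
  integrable := φ.integrable
  integrable_fourier := (𝓕 φ).integrable

/-- The symplectic form `⟨a', b⟩ - ⟨a, b'⟩` of `u = (a, b)` and `v = (a', b')`. -/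
def symplecticForm (p : Phase d × Phase d) : ℝ := inner ℝ p.2.1 p.1.2 - inner ℝ p.1.1 p.2.2

/-- The shift by 2πħb inside the second phase yields 2πħ⟨a', b⟩. The symmetric terms πħ⟨a, b⟩ in the
definition remove half of it together with ⟨a, b'⟩, which leaves the antisymmetric cocycle. -/
theorem weylShift_weylShift (ħ : ℝ) (u v : Phase d) (φ : Config d → ℂ) (x : Config d) :
    weylShift ħ u (weylShift ħ v φ) x =
      Complex.exp ((2 * Real.pi ^ 2 * ħ * symplecticForm (u, v) : ℝ) * Complex.I) *
        weylShift ħ (u + v) φ x := by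
  simp only [weylShift, symplecticForm, Prod.fst_add, Prod.snd_add, smul_add, add_assoc]
  rw [← mul_assoc, ← mul_assoc, ← Complex.exp_add, ← Complex.exp_add]
  congr 2
  simp only [inner_add_left, inner_add_right, inner_smul_right]
  push_cast
  ring

theorem norm_weylShift (ħ : ℝ) (u : Phase d) (φ : Config d → ℂ) (x : Config d) :
    ‖weylShift ħ u φ x‖ = ‖φ (x + (2 * Real.pi * ħ) • u.2)‖ := by
  rw [weylShift, norm_mul, Complex.norm_exp_ofReal_mul_I, one_mul]

theorem fourier_weylShift (ħ : ℝ) (u : Phase d) (φ : Config d → ℂ) (η : Config d) :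
    ‖𝓕 (weylShift ħ u φ) η‖ = ‖𝓕 φ (η - u.1)‖ := by
  have h : 𝓕 (weylShift ħ u φ) η =
      Complex.exp ((2 * Real.pi * (inner ℝ u.2 ((2 * Real.pi * ħ) • (η - u.1)) +
        Real.pi * ħ * inner ℝ u.1 u.2) : ℝ) * Complex.I) * 𝓕 φ (η - u.1) := by
    rw [Real.fourier_eq', Real.fourier_eq', ← integral_const_mul]
    refine Eq.trans ?_ (integral_add_right_eq_self _ ((2 * Real.pi * ħ) • u.2))
    refine integral_congr_ae (.of_forall fun y => ?_)
    simp only [weylShift, smul_eq_mul]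
    rw [← mul_assoc, ← mul_assoc, ← Complex.exp_add, ← Complex.exp_add]
    congr 2
    simp only [inner_add_left, inner_smul_right, inner_smul_left, inner_sub_right,
      real_inner_comm y, real_inner_comm u.2, RCLike.conj_to_real]
    push_cast
    ring
  rw [h, norm_mul, Complex.norm_exp_ofReal_mul_I, one_mul]

theorem continuous_fourier {φ : Config d → ℂ} (hφ : Integrable φ) : Continuous (𝓕 φ) :=
  VectorFourier.fourierIntegral_continuous Real.continuous_fourierChar
    (by exact continuous_inner) hφ

theorem isTame_weylShift (ħ : ℝ) (u : Phase d) {φ : Config d → ℂ} (hφ : IsTame φ) :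
    IsTame (weylShift ħ u φ) := by
  have hc : Continuous (weylShift ħ u φ) := by
    have := hφ.continuous
    unfold weylShift; fun_prop
  have hi : Integrable (weylShift ħ u φ) :=
    (hφ.integrable.comp_add_right ((2 * Real.pi * ħ) • u.2)).mono hc.aestronglyMeasurable
      (.of_forall fun x => (norm_weylShift ħ u φ x).le)
  obtain ⟨C, hC⟩ := hφ.bounded
  refine ⟨hc, ⟨C, fun x => (norm_weylShift ħ u φ x).trans_le (hC _)⟩, hi, ?_⟩
  exact (hφ.integrable_fourier.comp_sub_right u.1).mono
    (continuous_fourier hi).aestronglyMeasurable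
    (.of_forall fun x => (fourier_weylShift ħ u φ x).le)

theorem weylFun_congr_ae (ħ : ℝ) (σ : 𝓢(Phase d, ℂ)) {φ ψ : Config d → ℂ} (h : φ =ᵐ[volume] ψ)
    (x : Config d) : weylFun ħ σ φ x = weylFun ħ σ ψ x := by
  refine integral_congr_ae ?_
  have h := Measure.quasiMeasurePreserving_fst (μ := (volume : Measure (Config d)))
    (ν := (volume : Measure (Config d))) |>.ae h
  filter_upwards [h] with p hp
  rw [weylIntegrand, weylIntegrand, hp]

/-- The oscillating factor in Weyl's formula. -/
def weylPhase (ħ : ℝ) (x : Config d) (p : Config d × Config d) : ℂ :=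
  Complex.exp (Complex.I * (inner ℝ p.2 (x - p.1) : ℝ) / (ħ : ℂ))

theorem norm_weylPhase (ħ : ℝ) (x : Config d) (p : Config d × Config d) :
    ‖weylPhase ħ x p‖ = 1 := by
  have : Complex.I * (inner ℝ p.2 (x - p.1) : ℝ) / (ħ : ℂ)
      = ((inner ℝ p.2 (x - p.1) / ħ : ℝ) : ℂ) * Complex.I := by
    push_cast; ring
  rw [weylPhase, this, Complex.norm_exp_ofReal_mul_I]

theorem continuous_weylIntegrand (ħ : ℝ) (σ : 𝓢(Phase d, ℂ)) {φ : Config d → ℂ}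
    (hφ : Continuous φ) (x : Config d) : Continuous (weylIntegrand ħ σ φ x) := by
  unfold weylIntegrand
  have h : Continuous fun p : Config d × Config d => σ ((1 / 2 : ℝ) • (x + p.1), p.2) :=
    σ.continuous.comp (by fun_prop)
  fun_prop

theorem integrable_symbol_midpoint (σ : 𝓢(Phase d, ℂ)) (x : Config d) :
    Integrable fun p : Config d × Config d => σ ((1 / 2 : ℝ) • (x + p.1), p.2) := by
  obtain ⟨C, hC, h⟩ := norm_symbol_le σ
  have h1 : Integrable fun y : Config d => decayWeight ((1 / 2 : ℝ) • (x + y)) :=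
    (integrable_decayWeight.comp_smul (by norm_num : (1 / 2 : ℝ) ≠ 0)).comp_add_left x
  refine ((h1.mul_prod integrable_decayWeight).const_mul C).mono' ?_ (.of_forall fun p => h _ _)
  exact (σ.continuous.comp (by fun_prop)).aestronglyMeasurable

theorem decayWeight_le_one (v : Config d) : decayWeight v ≤ 1 := by
  unfold decayWeight
  exact Real.rpow_le_one_of_one_le_of_nonpos (by simp) (by linarith [Nat.cast_nonneg (α := ℝ) d])

theorem integrable_weylIntegrand_of_integrable (ħ : ℝ) (σ : 𝓢(Phase d, ℂ)) {φ : Config d → ℂ}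
    (hφ : Integrable φ) (hc : Continuous φ) (x : Config d) :
    Integrable (weylIntegrand ħ σ φ x) := by
  obtain ⟨C, hC, h⟩ := norm_symbol_le σ
  refine ((hφ.norm.mul_prod integrable_decayWeight).const_mul
    (C / ‖(2 * Real.pi * ħ : ℂ) ^ d‖)).mono' (continuous_weylIntegrand ħ σ hc x).aestronglyMeasurable
    (.of_forall fun p => ?_)
  rw [norm_weylIntegrand]
  calc _ ≤ C * (decayWeight ((1 / 2 : ℝ) • (x + p.1)) * decayWeight p.2) * ‖φ p.1‖ /
        ‖(2 * Real.pi * ħ : ℂ) ^ d‖ := by gcongr; exact h _ _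
    _ ≤ C * (1 * decayWeight p.2) * ‖φ p.1‖ / ‖(2 * Real.pi * ħ : ℂ) ^ d‖ := by
        gcongr
        · exact decayWeight_nonneg _
        · exact decayWeight_le_one _
    _ = _ := by ring

/-- The `y`-integral in the Weyl quantization of a plane wave. -/
theorem integral_phaseWave_weylPhase {ħ : ℝ} (hħ : 0 < ħ) (u : Phase d) (φ : Config d → ℂ)
    (x ξ : Config d) :
    ∫ y, phaseWave u ((1 / 2 : ℝ) • (x + y), ξ) * weylPhase ħ x (y, ξ) * φ y =
      Complex.exp ((2 * Real.pi * ((1 / 2) * inner ℝ u.1 x +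
        inner ℝ ξ ((2 * Real.pi * ħ)⁻¹ • x + u.2)) : ℝ) * Complex.I) *
        𝓕 φ ((2 * Real.pi * ħ)⁻¹ • ξ - (1 / 2 : ℝ) • u.1) := by
  rw [Real.fourier_eq', ← integral_const_mul]
  refine integral_congr_ae (.of_forall fun y => ?_)
  simp only [phaseWave, phaseDot, weylPhase, smul_eq_mul]
  rw [← mul_assoc, ← Complex.exp_add, ← Complex.exp_add]
  congr 2
  simp only [inner_add_right, inner_sub_right, inner_smul_right, real_inner_comm ξ,
    real_inner_comm u.1]
  have : (ħ : ℂ) ≠ 0 := by exact_mod_cast hħ.ne'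
  have : (Real.pi : ℂ) ≠ 0 := by exact_mod_cast Real.pi_ne_zero
  push_cast
  field_simp
  ring

/-- The remaining integral in the Weyl quantization of a plane wave. -/
theorem integral_fourier_eq_weylShift {ħ : ℝ} (hħ : 0 < ħ) (u : Phase d) {φ : Config d → ℂ}
    (hφ : IsTame φ) (x : Config d) :
    ∫ ξ, Complex.exp ((2 * Real.pi * ((1 / 2) * inner ℝ u.1 x +
        inner ℝ ξ ((2 * Real.pi * ħ)⁻¹ • x + u.2)) : ℝ) * Complex.I) *
        𝓕 φ ((2 * Real.pi * ħ)⁻¹ • ξ - (1 / 2 : ℝ) • u.1) =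
      (2 * Real.pi * ħ : ℂ) ^ d * weylShift ħ u φ x := by
  have hr : 0 < 2 * Real.pi * ħ := by positivity
  -- Substituting ξ = 2πħη produces the Jacobian (2πħ)^d. Translating η by half of `u.1` then leaves
  -- the inverse Fourier integral of 𝓕 φ at x + 2πħ u.2.
  have h1 := Measure.integral_comp_inv_smul (volume : Measure (Config d))
    (fun η : Config d => Complex.exp ((2 * Real.pi * ((1 / 2) * inner ℝ u.1 x +
        inner ℝ η (x + (2 * Real.pi * ħ) • u.2)) : ℝ) * Complex.I) *
        𝓕 φ (η - (1 / 2 : ℝ) • u.1)) (2 * Real.pi * ħ)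
  have h2 : 𝓕⁻ (𝓕 φ) (x + (2 * Real.pi * ħ) • u.2) = φ (x + (2 * Real.pi * ħ) • u.2) :=
    hφ.integrable.fourierInv_fourier_eq hφ.integrable_fourier hφ.continuous.continuousAt
  have h3 : ∫ η : Config d, Complex.exp ((2 * Real.pi * ((1 / 2) * inner ℝ u.1 x +
        inner ℝ η (x + (2 * Real.pi * ħ) • u.2)) : ℝ) * Complex.I) *
        𝓕 φ (η - (1 / 2 : ℝ) • u.1) = weylShift ħ u φ x := by
    rw [weylShift, ← h2, Real.fourierInv_eq', ← integral_const_mul,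
      ← integral_add_right_eq_self _ ((1 / 2 : ℝ) • u.1)]
    refine integral_congr_ae (.of_forall fun y => ?_)
    simp only [smul_eq_mul, add_sub_cancel_right]
    rw [← mul_assoc, ← Complex.exp_add]
    congr 2
    simp only [inner_add_left, inner_add_right, inner_smul_right, inner_smul_left]
    push_cast
    simp
    ring
  rw [h3, finrank_euclideanSpace_fin, abs_of_pos (by positivity)] at h1
  rw [show (2 * Real.pi * ħ : ℂ) ^ d = (((2 * Real.pi * ħ) ^ d : ℝ) : ℂ) by push_cast; rfl,
    ← Complex.real_smul, ← h1]
  refine integral_congr_ae (.of_forall fun ξ => ?_)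
  simp only
  congr 4
  simp only [inner_add_right, inner_smul_right, inner_smul_left]
  simp
  field_simp

/-- For fixed s the integral over ξ of the modulus of 𝓕 φ is independent of s, by an affine change
of variables, so integrability of `c` suffices. -/
theorem integrable_fourier_superposition {ħ : ℝ} (hħ : 0 < ħ) {S : Type*} [MeasurableSpace S]
    {μ : Measure S} [SFinite μ] {c : S → ℂ} (hc : Integrable c μ) {u : S → Phase d}
    (hu : Measurable u) {φ : Config d → ℂ} (hφ : IsTame φ) (x : Config d) :
    Integrable (fun p : Config d × S => c p.2 *
      (Complex.exp ((2 * Real.pi * ((1 / 2) * inner ℝ (u p.2).1 x +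
        inner ℝ p.1 ((2 * Real.pi * ħ)⁻¹ • x + (u p.2).2)) : ℝ) * Complex.I) *
        𝓕 φ ((2 * Real.pi * ħ)⁻¹ • p.1 - (1 / 2 : ℝ) • (u p.2).1))) (volume.prod μ) := by
  have hcF := continuous_fourier hφ.integrable
  have hcont : Continuous fun q : Config d × Phase d =>
      Complex.exp ((2 * Real.pi * ((1 / 2) * inner ℝ q.2.1 x +
        inner ℝ q.1 ((2 * Real.pi * ħ)⁻¹ • x + q.2.2)) : ℝ) * Complex.I) *
        𝓕 φ ((2 * Real.pi * ħ)⁻¹ • q.1 - (1 / 2 : ℝ) • q.2.1) := by fun_prop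
  have hr : (2 * Real.pi * ħ)⁻¹ ≠ 0 := by positivity
  have hm := (hcont.measurable.comp (measurable_fst.prodMk (hu.comp measurable_snd) :
    Measurable fun p : Config d × S => (p.1, u p.2))).aestronglyMeasurable
    (μ := (volume : Measure (Config d)).prod μ)
  have hF : Integrable (fun p : Config d × S =>
      ‖c p.2‖ * ‖𝓕 φ ((2 * Real.pi * ħ)⁻¹ • p.1 - (1 / 2 : ℝ) • (u p.2).1)‖)
      (volume.prod μ) := by
    have hcF' : Continuous fun q : Config d × Phase d =>
      ‖𝓕 φ ((2 * Real.pi * ħ)⁻¹ • q.1 - (1 / 2 : ℝ) • q.2.1)‖ := by fun_prop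
    have hm' := (hcF'.measurable.comp (measurable_fst.prodMk (hu.comp measurable_snd) :
      Measurable fun p : Config d × S => (p.1, u p.2))).aestronglyMeasurable
      (μ := (volume : Measure (Config d)).prod μ)
    have hI : ∀ a : Config d, Integrable fun ξ : Config d =>
        ‖𝓕 φ ((2 * Real.pi * ħ)⁻¹ • ξ - a)‖ := fun a =>
      ((hφ.integrable_fourier.comp_sub_right a).comp_smul hr).norm
    have hm'' : AEStronglyMeasurable (fun p : Config d × S =>
        ‖c p.2‖ * ‖𝓕 φ ((2 * Real.pi * ħ)⁻¹ • p.1 - (1 / 2 : ℝ) • (u p.2).1)‖)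
        (volume.prod μ) := hc.1.norm.comp_snd.mul hm'
    refine (integrable_prod_iff' hm'').2
      ⟨.of_forall fun s => (hI ((1 / 2 : ℝ) • (u s).1)).const_mul ‖c s‖, ?_⟩
    have hconst : ∀ a : Config d, ∫ ξ, ‖𝓕 φ ((2 * Real.pi * ħ)⁻¹ • ξ - a)‖ =
        |((2 * Real.pi * ħ)⁻¹ ^ Module.finrank ℝ (Config d))⁻¹| • ∫ ξ, ‖𝓕 φ ξ‖ := fun a => by
      rw [Measure.integral_comp_smul volume (fun η => ‖𝓕 φ (η - a)‖),
        integral_sub_right_eq_self (fun η => ‖𝓕 φ η‖)]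
    simp only [norm_mul, norm_norm, integral_const_mul, hconst]
    exact hc.norm.mul_const _
  refine hF.mono' (hc.1.comp_snd.mul hm) (.of_forall fun p => ?_)
  rw [norm_mul, norm_mul, Complex.norm_exp_ofReal_mul_I, one_mul]

/-- The Weyl quantization of a superposition of plane waves is the superposition of the
Heisenberg translations. -/
theorem weylFun_superposition {ħ : ℝ} (hħ : 0 < ħ) {S : Type*} [MeasurableSpace S] {μ : Measure S}
    [SFinite μ] {c : S → ℂ} (hc : Integrable c μ) {u : S → Phase d} (hu : Measurable u)
    {ρ : 𝓢(Phase d, ℂ)} (hρ : ∀ X, ρ X = ∫ s, c s * phaseWave (u s) X ∂μ)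
    {φ : Config d → ℂ} (hφ : IsTame φ) (x : Config d) :
    weylFun ħ ρ φ x = ∫ s, c s * weylShift ħ (u s) φ x ∂μ := by
  have hK : (2 * Real.pi * ħ : ℂ) ^ d ≠ 0 := by
    refine pow_ne_zero _ ?_
    exact_mod_cast (by positivity : (2 * Real.pi * ħ : ℝ) ≠ 0)
  set E : Config d → S → ℂ := fun ξ s =>
    Complex.exp ((2 * Real.pi * ((1 / 2) * inner ℝ (u s).1 x +
        inner ℝ ξ ((2 * Real.pi * ħ)⁻¹ • x + (u s).2)) : ℝ) * Complex.I) *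
        𝓕 φ ((2 * Real.pi * ħ)⁻¹ • ξ - (1 / 2 : ℝ) • (u s).1) with hE
  -- In (s, y, ξ) the expanded integrand has no decay in ξ, so a single Fubini is not available. At
  -- fixed ξ the variables s and y are exchanged; the y-integral then produces 𝓕 φ, whose
  -- integrability permits the exchange of s and ξ.
  have step2 : ∀ ξ, ∫ y, weylIntegrand ħ ρ φ x (y, ξ) =
      ∫ s, c s * E ξ s / (2 * Real.pi * ħ : ℂ) ^ d ∂μ := by
    intro ξ
    have e1 : ∀ y, weylIntegrand ħ ρ φ x (y, ξ) = ∫ s, c s *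
        (phaseWave (u s) ((1 / 2 : ℝ) • (x + y), ξ) * weylPhase ħ x (y, ξ) * φ y) /
          (2 * Real.pi * ħ : ℂ) ^ d ∂μ := by
      intro y
      rw [weylIntegrand, hρ, integral_div, ← integral_mul_const, ← integral_mul_const]
      congr 1
      refine integral_congr_ae (.of_forall fun s => ?_)
      simp only [weylPhase]
      ring
    simp_rw [e1]
    rw [integral_integral_swap]
    · refine integral_congr_ae (.of_forall fun s => ?_)
      simp only
      rw [integral_div, integral_const_mul, integral_phaseWave_weylPhase hħ]
    · have hcont : Continuous fun q : Phase d × Config d =>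
          phaseWave q.1 ((1 / 2 : ℝ) • (x + q.2), ξ) * weylPhase ħ x (q.2, ξ) := by
        unfold phaseWave phaseDot weylPhase; fun_prop
      have hb := (hφ.integrable.mul_prod hc).bdd_mul (c := 1)
        (f := fun p : Config d × S => phaseWave (u p.2) ((1 / 2 : ℝ) • (x + p.1), ξ) *
          weylPhase ħ x (p.1, ξ))
        (hcont.measurable.comp ((hu.comp measurable_snd).prodMk
          measurable_fst)).aestronglyMeasurable
        (.of_forall fun p => by rw [norm_mul, norm_phaseWave, norm_weylPhase, one_mul])
      refine (hb.div_const ((2 * Real.pi * ħ : ℂ) ^ d)).congr (.of_forall fun p => ?_)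
      simp only [Function.uncurry]
      ring
  have step1 : weylFun ħ ρ φ x = ∫ ξ, ∫ y, weylIntegrand ħ ρ φ x (y, ξ) := by
    rw [weylFun, Measure.volume_eq_prod]
    exact integral_prod_symm _
      (integrable_weylIntegrand_of_integrable ħ ρ hφ.integrable hφ.continuous x)
  rw [step1]
  simp_rw [step2]
  rw [integral_integral_swap]
  · refine integral_congr_ae (.of_forall fun s => ?_)
    simp only
    rw [integral_div, integral_const_mul, integral_fourier_eq_weylShift hħ _ hφ]
    field_simp
  · exact (integrable_fourier_superposition hħ hc hu hφ x).div_const _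

end Heisenberg

/-! ### Composition of Weyl operators and the Moyal bracket -/

section Moyal

open FourierTransform LineDeriv

variable {d : ℕ}

instance isAddHaarMeasure_phase : (volume : Measure (Phase d)).IsAddHaarMeasure :=
  inferInstanceAs (Measure.prod (volume : Measure (Config d)) volume).IsAddHaarMeasure

instance isAddHaarMeasure_phasePair : (volume : Measure (Phase d × Phase d)).IsAddHaarMeasure :=
  Measure.prod.instIsAddHaarMeasure (volume : Measure (Phase d)) (volume : Measure (Phase d))

theorem weylFun_eq_integral_weylShift {ħ : ℝ} (hħ : 0 < ħ) (σ : 𝓢(Phase d, ℂ))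
    {φ : Config d → ℂ} (hφ : IsTame φ) (x : Config d) :
    weylFun ħ σ φ x = ∫ u, phaseFourier d σ u * weylShift ħ u φ x :=
  weylFun_superposition hħ (phaseFourier d σ).integrable measurable_id
    (phaseFourier_inversion σ) hφ x

theorem integrable_tensor_weylShift (ħ : ℝ) (f g : 𝓢(Phase d, ℂ)) {φ : Config d → ℂ}
    (hφ : IsTame φ) (x : Config d) :
    Integrable fun p : Phase d × Phase d =>
      f p.1 * g p.2 * weylShift ħ p.1 (weylShift ħ p.2 φ) x := by
  obtain ⟨C, hC⟩ := hφ.bounded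
  have hc := hφ.continuous
  refine (f.integrable.mul_prod g.integrable).mul_bdd (c := C)
    (Continuous.aestronglyMeasurable ?_) (.of_forall fun p => ?_)
  · unfold weylShift; fun_prop
  · rw [norm_weylShift, norm_weylShift]; exact hC _

theorem integrable_superposed_weylIntegrand (ħ : ℝ) (σ f : 𝓢(Phase d, ℂ)) {φ : Config d → ℂ}
    (hφ : IsTame φ) (x : Config d) :
    Integrable (fun q : (Config d × Config d) × Phase d =>
      f q.2 * weylIntegrand ħ σ (weylShift ħ q.2 φ) x q.1) (volume.prod volume) := by
  obtain ⟨C, hC⟩ := hφ.bounded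
  have hc := hφ.continuous
  have hcont : Continuous fun q : (Config d × Config d) × Phase d =>
      weylPhase ħ x q.1 * weylShift ħ q.2 φ q.1.1 := by
    unfold weylPhase weylShift; fun_prop
  have h1 : Integrable (fun q : (Config d × Config d) × Phase d =>
      σ ((1 / 2 : ℝ) • (x + q.1.1), q.1.2) * f q.2) (volume.prod volume) :=
    (integrable_symbol_midpoint σ x).mul_prod (f.integrable (μ := volume))
  have h2 := (h1.mul_bdd (c := C) hcont.aestronglyMeasurable (.of_forall fun q => by
    rw [norm_mul, norm_weylPhase, one_mul, norm_weylShift]; exact hC _)).div_const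
      ((2 * Real.pi * ħ : ℂ) ^ d)
  refine h2.congr (.of_forall fun q => ?_)
  simp only [weylIntegrand, weylPhase]
  ring

/-- The inner operator is expanded first, and the outer integral is exchanged with the
superposition. The Heisenberg formula for σ is then needed only on translates of φ, which are tame;
no regularity of `weylFun ħ τ φ` is required. -/
theorem weylFun_weylFun {ħ : ℝ} (hħ : 0 < ħ) (σ τ : 𝓢(Phase d, ℂ)) {φ : Config d → ℂ}
    (hφ : IsTame φ) (x : Config d) :
    weylFun ħ σ (weylFun ħ τ φ) x = ∫ p : Phase d × Phase d,
      phaseFourier d σ p.1 * phaseFourier d τ p.2 *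
        weylShift ħ p.1 (weylShift ħ p.2 φ) x := by
  have hτ : weylFun ħ τ φ = fun y => ∫ v, phaseFourier d τ v * weylShift ħ v φ y :=
    funext (weylFun_eq_integral_weylShift hħ τ hφ)
  have e1 : ∀ p, weylIntegrand ħ σ (weylFun ħ τ φ) x p =
      ∫ v, phaseFourier d τ v * weylIntegrand ħ σ (weylShift ħ v φ) x p := by
    intro p
    rw [hτ]
    simp only [weylIntegrand]
    rw [← integral_const_mul, ← integral_div]
    refine integral_congr_ae (.of_forall fun v => ?_)
    simp only
    ring
  have e2 : weylFun ħ σ (weylFun ħ τ φ) x =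
      ∫ v, phaseFourier d τ v * weylFun ħ σ (weylShift ħ v φ) x := by
    rw [weylFun]
    simp_rw [e1]
    rw [integral_integral_swap (integrable_superposed_weylIntegrand ħ σ (phaseFourier d τ) hφ x)]
    simp_rw [integral_const_mul]
    rfl
  rw [e2]
  refine Eq.trans ?_ (integral_prod_symm _ (integrable_tensor_weylShift ħ (phaseFourier d σ)
    (phaseFourier d τ) hφ x)).symm
  refine integral_congr_ae (.of_forall fun v => ?_)
  simp only
  rw [weylFun_eq_integral_weylShift hħ σ (isTame_weylShift ħ v hφ), ← integral_const_mul]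
  refine integral_congr_ae (.of_forall fun u => ?_)
  simp only
  ring

theorem hasTemperateGrowth_symplecticForm :
    (symplecticForm : Phase d × Phase d → ℝ).HasTemperateGrowth := by
  have h1 : (fun p : Phase d × Phase d => inner ℝ p.2.1 p.1.2).HasTemperateGrowth :=
    (innerSL ℝ (E := Config d)).bilinear_hasTemperateGrowth
      ((ContinuousLinearMap.fst ℝ (Config d) (Config d)).comp
        (ContinuousLinearMap.snd ℝ (Phase d) (Phase d))).hasTemperateGrowth
      ((ContinuousLinearMap.snd ℝ (Config d) (Config d)).comp
        (ContinuousLinearMap.fst ℝ (Phase d) (Phase d))).hasTemperateGrowth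
  have h2 : (fun p : Phase d × Phase d => inner ℝ p.1.1 p.2.2).HasTemperateGrowth :=
    (innerSL ℝ (E := Config d)).bilinear_hasTemperateGrowth
      ((ContinuousLinearMap.fst ℝ (Config d) (Config d)).comp
        (ContinuousLinearMap.fst ℝ (Phase d) (Phase d))).hasTemperateGrowth
      ((ContinuousLinearMap.snd ℝ (Config d) (Config d)).comp
        (ContinuousLinearMap.snd ℝ (Phase d) (Phase d))).hasTemperateGrowth
  exact h1.sub h2

/-- The multiplier `sin (2π²ħ s) / (2π²ħ)`, where `s` is the symplectic form. -/
def moyalMultiplier (ħ : ℝ) (p : Phase d × Phase d) : ℝ :=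
  Real.sin (2 * Real.pi ^ 2 * ħ * symplecticForm p) / (2 * Real.pi ^ 2 * ħ)

theorem hasTemperateGrowth_moyalMultiplier {ħ : ℝ} (hħ : 0 < ħ) :
    (moyalMultiplier ħ : Phase d × Phase d → ℝ).HasTemperateGrowth :=
  hasTemperateGrowth_sin_div hasTemperateGrowth_symplecticForm (by positivity)

/-- The Moyal bracket of two Schwartz symbols. -/
def moyalBracket (ħ : ℝ) (σ τ : 𝓢(Phase d, ℂ)) : 𝓢(Phase d, ℂ) :=
  (4 * Real.pi ^ 2 : ℂ) • phaseSynthesis d (SchwartzMap.smulLeftCLM ℂ (moyalMultiplier ħ)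
    (schwartzTensor (phaseFourier d σ) (phaseFourier d τ)))

/-- The symplectic form is antisymmetric, so the two phases are conjugate and differ by 2i sin θ;
division by iħ gives 2 sin θ / ħ. -/
theorem sub_exp_eq_moyalMultiplier {ħ : ℝ} (hħ : 0 < ħ) (p : Phase d × Phase d) :
    (Complex.I * (ħ : ℂ))⁻¹ *
      (Complex.exp ((2 * Real.pi ^ 2 * ħ * symplecticForm p : ℝ) * Complex.I) -
        Complex.exp ((2 * Real.pi ^ 2 * ħ * symplecticForm p.swap : ℝ) * Complex.I)) =
      4 * Real.pi ^ 2 * moyalMultiplier ħ p := by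
  have hs : symplecticForm p.swap = -symplecticForm p := by
    simp only [symplecticForm, Prod.fst_swap, Prod.snd_swap]; ring
  have hħ' : (ħ : ℂ) ≠ 0 := by exact_mod_cast hħ.ne'
  have hpi : (Real.pi : ℂ) ≠ 0 := by exact_mod_cast Real.pi_ne_zero
  rw [hs, moyalMultiplier, Complex.exp_mul_I, Complex.exp_mul_I]
  set θ := 2 * Real.pi ^ 2 * ħ * symplecticForm p with hθ
  rw [mul_neg, ← hθ, Complex.ofReal_neg, Complex.cos_neg, Complex.sin_neg]
  push_cast
  field_simp
  ring

theorem weylFun_moyalBracket {ħ : ℝ} (hħ : 0 < ħ) (σ τ : 𝓢(Phase d, ℂ)) {φ : Config d → ℂ}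
    (hφ : IsTame φ) (x : Config d) :
    weylFun ħ (moyalBracket ħ σ τ) φ x = (Complex.I * (ħ : ℂ))⁻¹ *
      (weylFun ħ σ (weylFun ħ τ φ) x - weylFun ħ τ (weylFun ħ σ φ) x) := by
  set H : 𝓢(Phase d × Phase d, ℂ) := (4 * Real.pi ^ 2 : ℂ) •
    SchwartzMap.smulLeftCLM ℂ (moyalMultiplier ħ)
      (schwartzTensor (phaseFourier d σ) (phaseFourier d τ)) with hH
  have hHa : ∀ p, H p = 4 * Real.pi ^ 2 * moyalMultiplier ħ p *
      (phaseFourier d σ p.1 * phaseFourier d τ p.2) := fun p => by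
    rw [hH, smul_apply, SchwartzMap.smulLeftCLM_apply_apply
      (hasTemperateGrowth_moyalMultiplier hħ)]
    simp only [schwartzTensor_apply, smul_eq_mul, Complex.real_smul]
    ring
  have hρ : ∀ X, moyalBracket ħ σ τ X = ∫ p, H p * phaseWave (p.1 + p.2) X := fun X => by
    rw [moyalBracket, ← map_smul, phaseSynthesis_apply]
  have hm : Measurable fun p : Phase d × Phase d => p.1 + p.2 := by fun_prop
  rw [weylFun_superposition hħ H.integrable hm hρ hφ, weylFun_weylFun hħ σ τ hφ,
    weylFun_weylFun hħ τ σ hφ]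
  -- After relabelling, both orders of composition are superpositions of the translation by p.1 +
  -- p.2 with the same amplitude, and differ only by the phase.
  have hswap : ∫ p : Phase d × Phase d, phaseFourier d τ p.1 * phaseFourier d σ p.2 *
        weylShift ħ p.1 (weylShift ħ p.2 φ) x =
      ∫ p : Phase d × Phase d, phaseFourier d τ p.2 * phaseFourier d σ p.1 *
        weylShift ħ p.2 (weylShift ħ p.1 φ) x := by
    rw [Measure.volume_eq_prod, ← integral_prod_swap]
    rfl
  have hint : Integrable fun p : Phase d × Phase d => phaseFourier d τ p.2 *
      phaseFourier d σ p.1 * weylShift ħ p.2 (weylShift ħ p.1 φ) x :=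
    (integrable_tensor_weylShift ħ (phaseFourier d τ) (phaseFourier d σ) hφ x).swap
  rw [hswap, ← integral_sub (integrable_tensor_weylShift ħ _ _ hφ x) hint, ← integral_const_mul]
  refine integral_congr_ae (.of_forall fun p => ?_)
  simp only
  rw [hHa, weylShift_weylShift, weylShift_weylShift, ← sub_exp_eq_moyalMultiplier hħ,
    add_comm p.2 p.1]
  simp only [Prod.swap, Prod.mk.eta]
  ring

/-- The Moyal bracket is the symbol of the quantum bracket. -/
theorem weylQuantization_moyalBracket {ħ : ℝ} (hħ : 0 < ħ) (σ τ : 𝓢(Phase d, ℂ)) :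
    weylQuantization ħ (moyalBracket ħ σ τ) =
      quantumBracket ħ (weylQuantization ħ σ) (weylQuantization ħ τ) := by
  -- The pointwise identity holds on tame functions; both sides are bounded operators, so density of
  -- Schwartz functions in L² concludes.
  have hd := SchwartzMap.denseRange_toLpCLM (E := Config d) (F := ℂ) (p := 2)
    (μ := (volume : Measure (Config d))) (by norm_num)
  refine ContinuousLinearMap.coeFn_injective
    (hd.equalizer (ContinuousLinearMap.continuous _) (ContinuousLinearMap.continuous _) ?_)
  funext φ
  have hφ : ((SchwartzMap.toLpCLM ℝ ℂ 2 (volume : Measure (Config d)) φ : L2 d) : Config d → ℂ)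
      =ᵐ[volume] φ := SchwartzMap.coeFn_toLp φ 2 volume
  simp only [Function.comp_apply]
  set Φ : L2 d := SchwartzMap.toLpCLM ℝ ℂ 2 (volume : Measure (Config d)) φ
  have h1 : ∀ ρ : 𝓢(Phase d, ℂ), weylQuantization ħ ρ Φ =ᵐ[volume] weylFun ħ ρ φ := fun ρ =>
    (coeFn_weylQuantization ħ ρ Φ).trans (.of_forall fun x => weylFun_congr_ae ħ ρ hφ x)
  have h2 : ∀ ρ ρ' : 𝓢(Phase d, ℂ), weylQuantization ħ ρ (weylQuantization ħ ρ' Φ) =ᵐ[volume]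
      weylFun ħ ρ (weylFun ħ ρ' φ) := fun ρ ρ' =>
    (coeFn_weylQuantization ħ ρ _).trans (.of_forall fun x => weylFun_congr_ae ħ ρ (h1 ρ') x)
  have h3 : quantumBracket ħ (weylQuantization ħ σ) (weylQuantization ħ τ) Φ =
      (Complex.I * (ħ : ℂ))⁻¹ • (weylQuantization ħ σ (weylQuantization ħ τ Φ) -
        weylQuantization ħ τ (weylQuantization ħ σ Φ)) := rfl
  rw [h3]
  refine Lp.ext ?_
  filter_upwards [h1 (moyalBracket ħ σ τ), h2 σ τ, h2 τ σ,
    Lp.coeFn_smul (Complex.I * (ħ : ℂ))⁻¹ (weylQuantization ħ σ (weylQuantization ħ τ Φ) -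
        weylQuantization ħ τ (weylQuantization ħ σ Φ)),
    Lp.coeFn_sub (weylQuantization ħ σ (weylQuantization ħ τ Φ))
      (weylQuantization ħ τ (weylQuantization ħ σ Φ))] with x a1 a2 a3 a4 a5
  rw [a1, a4, Pi.smul_apply, a5, Pi.sub_apply, a2, a3, smul_eq_mul,
    weylFun_moyalBracket hħ σ τ (isTame_schwartz φ)]

/-! ### The semi-classical limit of the Moyal bracket -/

theorem poissonBracket_apply (σ τ : 𝓢(Phase d, ℂ)) (X : Phase d) :
    poissonBracket σ τ X = ∑ j : Fin d,
      ((∂_{((EuclideanSpace.single j 1, 0) : Phase d)} σ) X *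
        (∂_{((0, EuclideanSpace.single j 1) : Phase d)} τ) X -
      (∂_{((0, EuclideanSpace.single j 1) : Phase d)} σ) X *
        (∂_{((EuclideanSpace.single j 1, 0) : Phase d)} τ) X) := by
  simp [poissonBracket]

/-- Each derivative multiplies the Fourier transform by 2πi times a frequency. Two of them give
-4π², and this sign turns ⟨a, b'⟩ - ⟨b, a'⟩ into the symplectic form. -/
theorem poissonBracket_eq_phaseSynthesis (σ τ : 𝓢(Phase d, ℂ)) :
    poissonBracket σ τ = (4 * Real.pi ^ 2 : ℂ) • phaseSynthesis d
      (SchwartzMap.smulLeftCLM ℂ symplecticForm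
        (schwartzTensor (phaseFourier d σ) (phaseFourier d τ))) := by
  have h : (4 * Real.pi ^ 2 : ℂ) • SchwartzMap.smulLeftCLM ℂ symplecticForm
        (schwartzTensor (phaseFourier d σ) (phaseFourier d τ)) =
      ∑ j : Fin d, (schwartzTensor
        (phaseFourier d (∂_{((EuclideanSpace.single j 1, 0) : Phase d)} σ))
        (phaseFourier d (∂_{((0, EuclideanSpace.single j 1) : Phase d)} τ)) -
      schwartzTensor (phaseFourier d (∂_{((0, EuclideanSpace.single j 1) : Phase d)} σ))
        (phaseFourier d (∂_{((EuclideanSpace.single j 1, 0) : Phase d)} τ))) := by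
    ext p
    rw [smul_apply, SchwartzMap.smulLeftCLM_apply_apply hasTemperateGrowth_symplecticForm]
    simp only [sum_apply, sub_apply, schwartzTensor_apply,
      phaseFourier_lineDerivOp, phaseDot, inner_zero_right, add_zero, zero_add,
      EuclideanSpace.inner_single_right, smul_eq_mul, Complex.real_smul, symplecticForm,
      RCLike.conj_to_real, one_mul]
    rw [PiLp.inner_apply, PiLp.inner_apply]
    push_cast
    rw [← Finset.sum_sub_distrib, Finset.sum_mul, Finset.mul_sum]
    refine Finset.sum_congr rfl fun j _ => ?_
    simp only [RCLike.inner_apply, RCLike.conj_to_real]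
    push_cast
    linear_combination (4 * (Real.pi : ℂ) ^ 2 * phaseFourier d σ p.1 * phaseFourier d τ p.2 *
      ((p.1.1 j : ℂ) * (p.2.2 j) - (p.1.2 j : ℂ) * (p.2.1 j))) * (-Complex.I_sq)
  rw [← map_smul, h, map_sum]
  ext X
  rw [poissonBracket_apply, sum_apply]
  simp only [map_sub, sub_apply, phaseSynthesis_tensor]

/-- The Moyal bracket converges to the Poisson bracket, jointly in both arguments. -/
theorem tendsto_moyalBracket {σ τ : ℝ → 𝓢(Phase d, ℂ)} {σ₀ τ₀ : 𝓢(Phase d, ℂ)}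
    (hσ : Tendsto σ (𝓝[>] 0) (𝓝 σ₀)) (hτ : Tendsto τ (𝓝[>] 0) (𝓝 τ₀)) :
    Tendsto (fun ħ => moyalBracket ħ (σ ħ) (τ ħ)) (𝓝[>] 0) (𝓝 (poissonBracket σ₀ τ₀)) := by
  rw [poissonBracket_eq_phaseSynthesis]
  refine Tendsto.const_smul ?_ _
  refine ((phaseSynthesis d).continuous.tendsto _).comp ?_
  have hT := Tendsto.schwartzTensor (((phaseFourier d).continuous.tendsto σ₀).comp hσ)
    (((phaseFourier d).continuous.tendsto τ₀).comp hτ)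
  refine tendsto_smulLeftCLM ?_ hasTemperateGrowth_symplecticForm (fun n => ?_) hT
  · filter_upwards [self_mem_nhdsWithin] with ħ hħ
    exact hasTemperateGrowth_moyalMultiplier hħ
  -- With θ = 2π²ħ, the Moyal multiplier minus the symplectic form is exactly `sineDefect θ`
  -- composed with that form.
  · obtain ⟨N, K, hK, h⟩ := exists_norm_iteratedFDeriv_sineDefect_comp_le
      (hasTemperateGrowth_symplecticForm (d := d)) n
    refine ⟨N, fun ħ => 2 * Real.pi ^ 2 * ħ * (1 + 2 * Real.pi ^ 2 * ħ) ^ n * K, ?_, ?_⟩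
    · have hc : Continuous fun ħ : ℝ =>
          2 * Real.pi ^ 2 * ħ * (1 + 2 * Real.pi ^ 2 * ħ) ^ n * K := by fun_prop
      have := hc.tendsto 0
      simp only [mul_zero, zero_mul] at this
      exact this.mono_left nhdsWithin_le_nhds
    · filter_upwards [self_mem_nhdsWithin] with ħ hħ
      have hħ : 0 < ħ := hħ
      exact ⟨by positivity, h _ (by positivity)⟩

end Moyal

/-! ### Injectivity of Weyl quantization -/

section Injectivity

open FourierTransform

variable {d : ℕ}

/-- Weyl quantization as a linear map. -/
def weylQuantizationLM (d : ℕ) (ħ : ℝ) : 𝓢(Phase d, ℂ) →ₗ[ℂ] (L2 d →L[ℂ] L2 d) where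
  toFun := weylQuantization ħ
  map_add' σ τ := by
    ext1 φ
    refine Lp.ext ?_
    rw [add_apply]
    filter_upwards [coeFn_weylQuantization ħ (σ + τ) φ, coeFn_weylQuantization ħ σ φ,
      coeFn_weylQuantization ħ τ φ,
      Lp.coeFn_add (weylQuantization ħ σ φ) (weylQuantization ħ τ φ)] with x h1 h2 h3 h4
    rw [h1, h4, Pi.add_apply, h2, h3, weylFun, weylFun, weylFun,
      ← integral_add (integrable_weylIntegrand ħ σ φ x) (integrable_weylIntegrand ħ τ φ x)]
    refine integral_congr_ae (.of_forall fun p => ?_)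
    simp only [weylIntegrand, add_apply]
    ring
  map_smul' c σ := by
    ext1 φ
    refine Lp.ext ?_
    rw [RingHom.id_apply, smul_apply]
    filter_upwards [coeFn_weylQuantization ħ (c • σ) φ, coeFn_weylQuantization ħ σ φ,
      Lp.coeFn_smul c (weylQuantization ħ σ φ)] with x h1 h2 h3
    rw [h1, h3, Pi.smul_apply, h2, weylFun, weylFun, smul_eq_mul, ← integral_const_mul]
    refine integral_congr_ae (.of_forall fun p => ?_)
    simp only [weylIntegrand, smul_apply, smul_eq_mul]
    ring

@[simp]
theorem weylQuantizationLM_apply (ħ : ℝ) (σ : 𝓢(Phase d, ℂ)) :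
    weylQuantizationLM d ħ σ = weylQuantization ħ σ := rfl

theorem norm_symbol_le_decayWeight (σ : 𝓢(Phase d, ℂ)) :
    ∃ C : ℝ, 0 ≤ C ∧ ∀ q ξ, ‖σ (q, ξ)‖ ≤ C * decayWeight ξ := by
  obtain ⟨C, hC, h⟩ := norm_symbol_le σ
  refine ⟨C, hC, fun q ξ => (h q ξ).trans ?_⟩
  gcongr
  exact mul_le_of_le_one_left (decayWeight_nonneg _) (decayWeight_le_one q)

theorem continuous_weylFun (ħ : ℝ) (σ : 𝓢(Phase d, ℂ)) (φ : 𝓢(Config d, ℂ)) :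
    Continuous (weylFun ħ σ φ) := by
  obtain ⟨C, hC, h⟩ := norm_symbol_le_decayWeight σ
  refine continuous_of_dominated (bound := fun p => C / ‖(2 * Real.pi * ħ : ℂ) ^ d‖ *
    (‖φ p.1‖ * decayWeight p.2)) (fun x => ?_) (fun x => .of_forall fun p => ?_) ?_
    (.of_forall fun p => ?_)
  · exact (continuous_weylIntegrand ħ σ φ.continuous x).aestronglyMeasurable
  · rw [norm_weylIntegrand]
    calc _ ≤ C * decayWeight p.2 * ‖φ p.1‖ / ‖(2 * Real.pi * ħ : ℂ) ^ d‖ := by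
          gcongr; exact h _ _
      _ = _ := by ring
  · exact (φ.integrable.norm.mul_prod integrable_decayWeight).const_mul _
  · unfold weylIntegrand
    have h : Continuous fun x : Config d => σ ((1 / 2 : ℝ) • (x + p.1), p.2) :=
      σ.continuous.comp (by fun_prop)
    fun_prop

/-- The integral kernel of a Weyl operator. -/
def weylKernel (ħ : ℝ) (σ : 𝓢(Phase d, ℂ)) (x y : Config d) : ℂ :=
  ∫ ξ, σ ((1 / 2 : ℝ) • (x + y), ξ) * weylPhase ħ x (y, ξ) / (2 * Real.pi * ħ : ℂ) ^ d

theorem continuous_weylKernel (ħ : ℝ) (σ : 𝓢(Phase d, ℂ)) (x : Config d) :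
    Continuous (weylKernel ħ σ x) := by
  obtain ⟨C, hC, h⟩ := norm_symbol_le_decayWeight σ
  refine continuous_of_dominated (bound := fun ξ => C / ‖(2 * Real.pi * ħ : ℂ) ^ d‖ *
    decayWeight ξ) (fun y => ?_) (fun y => .of_forall fun ξ => ?_) ?_ (.of_forall fun ξ => ?_)
  · have h1 : Continuous fun ξ : Config d => σ ((1 / 2 : ℝ) • (x + y), ξ) :=
      σ.continuous.comp (by fun_prop)
    unfold weylPhase
    exact Continuous.aestronglyMeasurable (by fun_prop)
  · rw [norm_div, norm_mul, norm_weylPhase, mul_one]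
    calc _ ≤ C * decayWeight ξ / ‖(2 * Real.pi * ħ : ℂ) ^ d‖ := by gcongr; exact h _ _
      _ = _ := by ring
  · exact integrable_decayWeight.const_mul _
  · have h1 : Continuous fun y : Config d => σ ((1 / 2 : ℝ) • (x + y), ξ) :=
      σ.continuous.comp (by fun_prop)
    unfold weylPhase
    fun_prop

theorem weylFun_eq_integral_weylKernel (ħ : ℝ) (σ : 𝓢(Phase d, ℂ)) (φ : 𝓢(Config d, ℂ))
    (x : Config d) : weylFun ħ σ φ x = ∫ y, φ y * weylKernel ħ σ x y := by
  rw [weylFun, Measure.volume_eq_prod, integral_prod _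
    (integrable_weylIntegrand_of_integrable ħ σ φ.integrable φ.continuous x)]
  refine integral_congr_ae (.of_forall fun y => ?_)
  simp only
  rw [weylKernel, ← integral_const_mul]
  refine integral_congr_ae (.of_forall fun ξ => ?_)
  simp only [weylIntegrand, weylPhase]
  ring

/-- The two points have midpoint q and difference -2πħη, so the Weyl phase becomes the Fourier
character e^{-2πi⟨ξ, η⟩}. -/
theorem fourier_symbol_eq_weylKernel {ħ : ℝ} (hħ : 0 < ħ) (σ : 𝓢(Phase d, ℂ)) (q η : Config d) :
    𝓕 (fun ξ => σ (q, ξ)) η = (2 * Real.pi * ħ : ℂ) ^ d *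
      weylKernel ħ σ (q - (Real.pi * ħ) • η) (q + (Real.pi * ħ) • η) := by
  have hK : (2 * Real.pi * ħ : ℂ) ^ d ≠ 0 := by
    refine pow_ne_zero _ ?_
    exact_mod_cast (by positivity : (2 * Real.pi * ħ : ℝ) ≠ 0)
  have hħ' : (ħ : ℂ) ≠ 0 := by exact_mod_cast hħ.ne'
  rw [Real.fourier_eq', weylKernel, ← integral_const_mul]
  refine integral_congr_ae (.of_forall fun ξ => ?_)
  have e1 : (1 / 2 : ℝ) • (q - (Real.pi * ħ) • η + (q + (Real.pi * ħ) • η)) = q := by module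
  have e2 : q - (Real.pi * ħ) • η - (q + (Real.pi * ħ) • η) = (-(2 * Real.pi * ħ)) • η := by
    module
  simp only [weylPhase, e1, e2, inner_smul_right, smul_eq_mul]
  rw [mul_div_cancel₀ _ hK, mul_comm]
  congr 2
  push_cast
  field_simp

/-- Continuity upgrades almost-everywhere vanishing on Schwartz functions to vanishing everywhere.
Compactly supported test functions then kill the kernel, hence the Fourier transform of each σ(q,
·), and inversion kills σ. -/
theorem eq_zero_of_weylQuantization_eq_zero {ħ : ℝ} (hħ : 0 < ħ) {σ : 𝓢(Phase d, ℂ)}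
    (h : weylQuantization ħ σ = 0) : σ = 0 := by
  have h1 : ∀ (φ : 𝓢(Config d, ℂ)) x, weylFun ħ σ φ x = 0 := by
    intro φ
    have hφ := SchwartzMap.coeFn_toLp φ 2 (volume : Measure (Config d))
    have ha : weylFun ħ σ φ =ᵐ[volume] fun _ => 0 := by
      have h2 := coeFn_weylQuantization ħ σ (φ.toLp 2 (volume : Measure (Config d)))
      rw [h, zero_apply] at h2
      filter_upwards [h2, Lp.coeFn_zero ℂ 2 (volume : Measure (Config d))] with x hx h0
      rw [← weylFun_congr_ae ħ σ hφ x, ← hx, h0, Pi.zero_apply]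
    exact congrFun ((continuous_weylFun ħ σ φ).ae_eq_iff_eq volume continuous_const |>.1 ha)
  have h2 : ∀ x y, weylKernel ħ σ x y = 0 := by
    intro x
    have hc := continuous_weylKernel ħ σ x
    have ha := ae_eq_zero_of_integral_contDiff_smul_eq_zero
      (hc.locallyIntegrable (μ := (volume : Measure (Config d)))) fun g hg hgc => by
        have hgs : HasCompactSupport fun y => (g y : ℂ) := hgc.comp_left Complex.ofReal_zero
        have := h1 (hgs.toSchwartzMap (Complex.ofRealCLM.contDiff.comp hg)) x
        rw [weylFun_eq_integral_weylKernel] at this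
        exact this
    exact congrFun ((hc.ae_eq_iff_eq volume continuous_const).1 ha)
  ext ⟨q, ξ⟩
  obtain ⟨C, hC, hb⟩ := norm_symbol_le_decayWeight σ
  have hcont : Continuous fun ξ => σ (q, ξ) := σ.continuous.comp (Continuous.prodMk_right q)
  have hi : Integrable fun ξ => σ (q, ξ) :=
    (integrable_decayWeight.const_mul C).mono' hcont.aestronglyMeasurable
      (.of_forall fun ξ => hb q ξ)
  have hF : 𝓕 (fun ξ => σ (q, ξ)) = fun _ => 0 := by
    funext η
    rw [fourier_symbol_eq_weylKernel hħ, h2, mul_zero]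
  have h3 := hi.fourierInv_fourier_eq (by rw [hF]; exact integrable_zero _ _ _)
    (hcont.continuousAt (x := ξ))
  rw [hF, Real.fourierInv_eq'] at h3
  simpa using h3.symm

theorem weylQuantization_injective {ħ : ℝ} (hħ : 0 < ħ) :
    Function.Injective (weylQuantization ħ : 𝓢(Phase d, ℂ) → _) := by
  intro σ τ h
  refine sub_eq_zero.1 (eq_zero_of_weylQuantization_eq_zero hħ ?_)
  rw [← weylQuantizationLM_apply, map_sub]
  simp [h]

end Injectivity

/-! ### Finiteness and naturality of mould expansions -/

section Expansions

variable {N L L' : Type*} [AddCommGroup L] [AddCommGroup L']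

/-- Bracketing with a series of order at least 1 raises the ε-order of the accumulator by at least
1; `k` tracks that order. -/
theorem foldl_seriesBracket_eq_zero_of_lt {br : L → L → L} (hl : ∀ a, br 0 a = 0)
    (hr : ∀ a, br a 0 = 0) {B : N → ℕ → L} (hB : ∀ n, B n 0 = 0) (w : List N) (acc : ℕ → L)
    (k : ℕ) (hacc : ∀ i < k, acc i = 0) (m : ℕ) (hm : m < k + w.length) :
    w.foldl (fun acc n' => seriesBracket br (B n') acc) acc m = 0 := by
  induction w generalizing acc k with
  | nil => exact hacc m (by simpa using hm)
  | cons n w ih =>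
    refine ih (seriesBracket br (B n) acc) (k + 1) (fun i hi => ?_) (by simp at hm; omega)
    refine Finset.sum_eq_zero fun p hp => ?_
    rw [Finset.HasAntidiagonal.mem_antidiagonal] at hp
    rcases Nat.eq_zero_or_pos p.1 with h | h
    · rw [h, hB, hl]
    · rw [hacc p.2 (by omega), hr]

theorem lieComould_eq_zero_of_lt {br : L → L → L} (hl : ∀ a, br 0 a = 0)
    (hr : ∀ a, br a 0 = 0) {B : N → ℕ → L} (hB : ∀ n, B n 0 = 0) (w : List N) (m : ℕ)
    (hm : m < w.length) : lieComould br B w m = 0 := by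
  cases w with
  | nil => rfl
  | cons n w =>
    -- The first letter is the initial accumulator and has order at least 1, which makes up for its
    -- absence from the folded word.
    refine foldl_seriesBracket_eq_zero_of_lt hl hr hB w (B n) 1 (fun i hi => ?_) m
      (by simp at hm; omega)
    rw [Nat.lt_one_iff.1 hi, hB]

/-- The disjunction is the induction invariant: the letter vanishing through order m has either
already annihilated the accumulator up to that order or is still to come. -/
theorem foldl_seriesBracket_eq_zero {br : L → L → L} (hl : ∀ a, br 0 a = 0)
    (hr : ∀ a, br a 0 = 0) {B : N → ℕ → L} (w : List N) (acc : ℕ → L) (m : ℕ)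
    (h : (∀ i ≤ m, acc i = 0) ∨ ∃ n ∈ w, ∀ i ≤ m, B n i = 0) :
    w.foldl (fun acc n' => seriesBracket br (B n') acc) acc m = 0 := by
  induction w generalizing acc with
  | nil =>
    rcases h with h | ⟨n, hn, -⟩
    · exact h m le_rfl
    · simp at hn
  | cons n w ih =>
    refine ih (seriesBracket br (B n) acc) ?_
    rcases h with h | ⟨n', hn', h⟩
    · refine Or.inl fun i hi => Finset.sum_eq_zero fun p hp => ?_
      rw [Finset.HasAntidiagonal.mem_antidiagonal] at hp
      rw [h p.2 (by omega), hr]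
    · rcases List.mem_cons.1 hn' with rfl | hn'
      · refine Or.inl fun i hi => Finset.sum_eq_zero fun p hp => ?_
        rw [Finset.HasAntidiagonal.mem_antidiagonal] at hp
        rw [h p.1 (by omega), hl]
      · exact Or.inr ⟨n', hn', h⟩

theorem lieComould_eq_zero_of_mem {br : L → L → L} (hl : ∀ a, br 0 a = 0)
    (hr : ∀ a, br a 0 = 0) {B : N → ℕ → L} {w : List N} {m : ℕ} {n : N} (hn : n ∈ w)
    (h : ∀ i ≤ m, B n i = 0) : lieComould br B w m = 0 := by
  cases w with
  | nil => rfl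
  | cons n' w =>
    refine foldl_seriesBracket_eq_zero hl hr w (B n') m ?_
    rcases List.mem_cons.1 hn with rfl | hn
    · exact Or.inl h
    · exact Or.inr ⟨n, hn, h⟩

/-- The words with at most `m` letters taken from a set. -/
def boundedWords (S : Set N) (m : ℕ) : Set (List N) := {w | w.length ≤ m ∧ ∀ n ∈ w, n ∈ S}

theorem finite_boundedWords {S : Set N} (hS : S.Finite) (m : ℕ) : (boundedWords S m).Finite := by
  have : Finite S := hS
  refine ((List.finite_length_le S m).image (List.map Subtype.val)).subset fun w hw => ?_
  refine ⟨w.attach.map fun n => ⟨n.1, hw.2 n.1 n.2⟩, by simpa using hw.1, ?_⟩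
  simp [List.map_map, Function.comp_def]

/-- The index set on the right does not depend on the bracket. The same finite sum thus serves the
Moyal, quantum and Poisson brackets, and limits in ħ can be taken term by term. -/
theorem mouldExpansion_eq_sum [Module ℂ L] {br : L → L → L} (hl : ∀ a, br 0 a = 0)
    (hr : ∀ a, br a 0 = 0) (F : Mould ℂ ℂ) (φ : N → ℂ) {B : N → ℕ → L} (hB : ∀ n, B n 0 = 0)
    {S : Set N} (hS : S.Finite) {m : ℕ} (hBS : ∀ n ∉ S, ∀ i ≤ m, B n i = 0) :
    mouldExpansion br F φ B m = ∑ w ∈ (finite_boundedWords hS m).toFinset,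
      ((w.length : ℂ)⁻¹ * F (w.map φ)) • lieComould br B w m := by
  refine finsum_eq_sum_of_support_subset _ fun w hw => ?_
  rw [Set.Finite.coe_toFinset]
  rw [Function.mem_support] at hw
  have h0 : lieComould br B w m ≠ 0 := fun h => hw (by rw [h, smul_zero])
  refine ⟨?_, fun n hn => ?_⟩
  · by_contra hlt
    exact h0 (lieComould_eq_zero_of_lt hl hr hB w m (not_le.1 hlt))
  · by_contra hnS
    exact h0 (lieComould_eq_zero_of_mem hl hr hn (hBS n hnS))

theorem map_foldl_seriesBracket {br : L → L → L} {br' : L' → L' → L'} (Q : L →+ L')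
    (hQ : ∀ a b, Q (br a b) = br' (Q a) (Q b)) (B : N → ℕ → L) (w : List N) (acc : ℕ → L)
    (m : ℕ) :
    Q (w.foldl (fun acc n' => seriesBracket br (B n') acc) acc m) =
      w.foldl (fun acc n' => seriesBracket br' (fun i => Q (B n' i)) acc)
        (fun i => Q (acc i)) m := by
  induction w generalizing acc with
  | nil => rfl
  | cons n w ih =>
    have e : (fun i => Q (seriesBracket br (B n) acc i)) =
        seriesBracket br' (fun i => Q (B n i)) fun i => Q (acc i) := by
      funext i
      simp only [seriesBracket, map_sum, hQ]
    rw [List.foldl_cons, List.foldl_cons, ih, e]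

theorem map_lieComould {br : L → L → L} {br' : L' → L' → L'} (Q : L →+ L')
    (hQ : ∀ a b, Q (br a b) = br' (Q a) (Q b)) (B : N → ℕ → L) (w : List N) (m : ℕ) :
    Q (lieComould br B w m) = lieComould br' (fun n i => Q (B n i)) w m := by
  cases w with
  | nil => exact map_zero Q
  | cons n w => exact map_foldl_seriesBracket Q hQ B w (B n) m

/-- The accumulator varies with t, so convergence of `br t` at fixed arguments would not be enough;
`hbr` asks for joint convergence. -/
theorem tendsto_foldl_seriesBracket [TopologicalSpace L] [ContinuousAdd L] {l : Filter ℝ}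
    {br : ℝ → L → L → L} {br₀ : L → L → L}
    (hbr : ∀ {f g : ℝ → L} {f₀ g₀ : L}, Tendsto f l (𝓝 f₀) → Tendsto g l (𝓝 g₀) →
      Tendsto (fun t => br t (f t) (g t)) l (𝓝 (br₀ f₀ g₀)))
    (B : N → ℕ → L) (w : List N) {acc : ℝ → ℕ → L} {acc₀ : ℕ → L}
    (hacc : ∀ i, Tendsto (fun t => acc t i) l (𝓝 (acc₀ i))) (m : ℕ) :
    Tendsto (fun t => w.foldl (fun acc n' => seriesBracket (br t) (B n') acc) (acc t) m) l
      (𝓝 (w.foldl (fun acc n' => seriesBracket br₀ (B n') acc) acc₀ m)) := by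
  induction w generalizing acc acc₀ with
  | nil => exact hacc m
  | cons n w ih =>
    exact ih fun i => tendsto_finsetSum _ fun p _ => hbr tendsto_const_nhds (hacc p.2)

theorem tendsto_lieComould [TopologicalSpace L] [ContinuousAdd L] {l : Filter ℝ}
    {br : ℝ → L → L → L} {br₀ : L → L → L}
    (hbr : ∀ {f g : ℝ → L} {f₀ g₀ : L}, Tendsto f l (𝓝 f₀) → Tendsto g l (𝓝 g₀) →
      Tendsto (fun t => br t (f t) (g t)) l (𝓝 (br₀ f₀ g₀)))
    (B : N → ℕ → L) (w : List N) (m : ℕ) :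
    Tendsto (fun t => lieComould (br t) B w m) l (𝓝 (lieComould br₀ B w m)) := by
  cases w with
  | nil => exact tendsto_const_nhds
  | cons n w =>
    exact tendsto_foldl_seriesBracket hbr B w (acc := fun _ => B n)
      (fun i => tendsto_const_nhds) m

end Expansions

/-! ### The symbol of the quantum normal form and its semi-classical limit -/

section Limit

variable {d : ℕ}

theorem moyalBracket_zero_left (ħ : ℝ) (σ : 𝓢(Phase d, ℂ)) : moyalBracket ħ 0 σ = 0 := by
  have : schwartzTensor (0 : 𝓢(Phase d, ℂ)) (phaseFourier d σ) = 0 := by ext; simp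
  rw [moyalBracket, map_zero, this, map_zero, map_zero, smul_zero]

theorem moyalBracket_zero_right (ħ : ℝ) (σ : 𝓢(Phase d, ℂ)) : moyalBracket ħ σ 0 = 0 := by
  have : schwartzTensor (phaseFourier d σ) (0 : 𝓢(Phase d, ℂ)) = 0 := by ext; simp
  rw [moyalBracket, map_zero, this, map_zero, map_zero, smul_zero]

theorem poissonBracket_zero_left (σ : 𝓢(Phase d, ℂ)) : poissonBracket 0 σ = 0 := by
  have : schwartzTensor (0 : 𝓢(Phase d, ℂ)) (phaseFourier d σ) = 0 := by ext; simp
  rw [poissonBracket_eq_phaseSynthesis, map_zero, this, map_zero, map_zero, smul_zero]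

theorem poissonBracket_zero_right (σ : 𝓢(Phase d, ℂ)) : poissonBracket σ 0 = 0 := by
  have : schwartzTensor (phaseFourier d σ) (0 : 𝓢(Phase d, ℂ)) = 0 := by ext; simp
  rw [poissonBracket_eq_phaseSynthesis, map_zero, this, map_zero, map_zero, smul_zero]

/-- The symbol of the quantum normal form, for components `B_n` of order `≥ 1` which form a formally
summable family. -/
theorem exists_symbol_quantumZ (ω : Fin d → ℝ) (F : Mould ℂ ℂ)
    {Bn : (Fin d → ℤ) → ℕ → 𝓢(Phase d, ℂ)} (hB0 : ∀ n, Bn n 0 = 0)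
    (hfin : ∀ m, {n | Bn n m ≠ 0}.Finite) :
    ∃ σ : ℝ → ℕ → 𝓢(Phase d, ℂ),
      (∀ ħ : ℝ, 0 < ħ → ∀ m : ℕ,
        IsWeylSymbol ħ (quantumZ ω F Bn ħ m) (σ ħ m) ∧
        ∀ τ : 𝓢(Phase d, ℂ), IsWeylSymbol ħ (quantumZ ω F Bn ħ m) τ → τ = σ ħ m) ∧
      ∀ m : ℕ, Tendsto (fun ħ => σ ħ m) (𝓝[>] 0) (𝓝 (classicalZ ω F Bn m)) := by
  -- All orders i ≤ m are collected, since a letter can contribute to ε^m through any of these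
  -- coefficients.
  have hS : ∀ m : ℕ, (⋃ i ∈ Set.Iic m, {n | Bn n i ≠ 0}).Finite := fun m =>
    (Set.finite_Iic m).biUnion fun i _ => hfin i
  have hBS : ∀ m, ∀ n ∉ ⋃ i ∈ Set.Iic m, {n | Bn n i ≠ 0}, ∀ i ≤ m, Bn n i = 0 := by
    intro m n hn i hi
    by_contra h
    exact hn (Set.mem_biUnion (x := i) hi h)
  refine ⟨fun ħ m => mouldExpansion (moyalBracket ħ) F (eigenvalue ω) Bn m,
    fun ħ hħ m => ?_, fun m => ?_⟩
  · have key : IsWeylSymbol ħ (quantumZ ω F Bn ħ m)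
        (mouldExpansion (moyalBracket ħ) F (eigenvalue ω) Bn m) := by
      rw [IsWeylSymbol, quantumZ,
        mouldExpansion_eq_sum (moyalBracket_zero_left ħ) (moyalBracket_zero_right ħ) F _ hB0
          (hS m) (hBS m),
        mouldExpansion_eq_sum (br := quantumBracket ħ) (fun a => by simp [quantumBracket])
          (fun a => by simp [quantumBracket]) F _
          (fun n => by rw [hB0, ← weylQuantizationLM_apply, map_zero]) (hS m)
          (fun n hn i hi => by rw [hBS m n hn i hi, ← weylQuantizationLM_apply, map_zero]),
        ← weylQuantizationLM_apply, map_sum]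
      refine Finset.sum_congr rfl fun w _ => ?_
      rw [map_smul]
      congr 1
      exact map_lieComould (weylQuantizationLM d ħ).toAddMonoidHom
        (weylQuantization_moyalBracket hħ) Bn w m
    exact ⟨key, fun τ hτ => weylQuantization_injective hħ (hτ.trans key.symm)⟩
  · rw [classicalZ, mouldExpansion_eq_sum poissonBracket_zero_left poissonBracket_zero_right F _ hB0
      (hS m) (hBS m)]
    simp only [fun ħ : ℝ => mouldExpansion_eq_sum (moyalBracket_zero_left ħ)
      (moyalBracket_zero_right ħ) F (eigenvalue ω) hB0 (hS m) (hBS m)]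
    exact tendsto_finsetSum _ fun w _ =>
      (tendsto_lieComould (fun hf hg => tendsto_moyalBracket hf hg) Bn w m).const_smul _

end Limit

/-! ### The homogeneous decomposition -/

section Decomposition

variable {d : ℕ}

theorem IsActionFunction.zero (ω : Fin d → ℝ) : IsActionFunction ω (0 : 𝓢(Phase d, ℂ)) :=
  ⟨fun _ => 0, contDiffOn_const, fun _ => rfl⟩

theorem IsActionFunction.add {ω : Fin d → ℝ} {f g : 𝓢(Phase d, ℂ)} (hf : IsActionFunction ω f)
    (hg : IsActionFunction ω g) : IsActionFunction ω (f + g) := by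
  obtain ⟨F, hF, hf⟩ := hf
  obtain ⟨G, hG, hg⟩ := hg
  exact ⟨F + G, hF.add hG, fun p => by rw [add_apply, hf, hg]; rfl⟩

theorem IsActionFunction.smul {ω : Fin d → ℝ} (c : ℂ) {f : 𝓢(Phase d, ℂ)}
    (hf : IsActionFunction ω f) : IsActionFunction ω (c • f) := by
  obtain ⟨F, hF, hf⟩ := hf
  exact ⟨c • F, hF.const_smul c, fun p => by rw [smul_apply, hf]; rfl⟩

/-- The complexification of a real Schwartz function. -/
def complexify (f : 𝓢(Phase d, ℝ)) : 𝓢(Phase d, ℂ) := f.postcompCLM Complex.ofRealCLM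

@[simp]
theorem complexify_apply (f : 𝓢(Phase d, ℝ)) (p : Phase d) : complexify f p = (f p : ℂ) := rfl

theorem IsActionFunction.complexify {ω : Fin d → ℝ} {f : 𝓢(Phase d, ℝ)}
    (hf : IsActionFunction ω f) : IsActionFunction ω (complexify f) := by
  obtain ⟨F, hF, hf⟩ := hf
  exact ⟨fun t => (F t : ℂ), Complex.ofRealCLM.contDiff.comp_contDiffOn hF,
    fun p => by rw [complexify_apply, hf]⟩

/-- The homogeneous Schwartz functions of degree `n`. -/
def homogeneousSubmodule (ω : Fin d → ℝ) (n : Fin d → ℤ) : Submodule ℂ 𝓢(Phase d, ℂ) where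
  carrier := {f | IsHomogeneous ω n f}
  zero_mem' := ⟨∅, 0, by simp, fun p => by simp⟩
  add_mem' := by
    rintro f g ⟨Ω₁, c₁, h₁, hf⟩ ⟨Ω₂, c₂, h₂, hg⟩
    classical
    -- The coefficients are cut off because nothing is known about `c₁` outside `Ω₁`, nor about `c₂`
    -- outside `Ω₂`.
    refine ⟨Ω₁ ∪ Ω₂, fun κ => (if κ ∈ Ω₁ then c₁ κ else 0) + (if κ ∈ Ω₂ then c₂ κ else 0),
      fun κ hκ => ⟨?_, ?_⟩, fun p => ?_⟩
    · refine IsActionFunction.add ?_ ?_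
      · split_ifs with h
        · exact (h₁ κ h).1
        · exact .zero ω
      · split_ifs with h
        · exact (h₂ κ h).1
        · exact .zero ω
    · rcases Finset.mem_union.1 hκ with h | h
      · exact (h₁ κ h).2
      · exact (h₂ κ h).2
    · rw [add_apply, hf, hg]
      simp only [add_apply, add_mul, Finset.sum_add_distrib]
      congr 1
      · rw [← Finset.sum_subset Finset.subset_union_left]
        · exact Finset.sum_congr rfl fun κ hκ => by rw [if_pos hκ]
        · intro κ _ hκ
          rw [if_neg hκ, zero_apply, zero_mul]
      · rw [← Finset.sum_subset Finset.subset_union_right]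
        · exact Finset.sum_congr rfl fun κ hκ => by rw [if_pos hκ]
        · intro κ _ hκ
          rw [if_neg hκ, zero_apply, zero_mul]
  smul_mem' := by
    rintro a f ⟨Ω, c, h, hf⟩
    refine ⟨Ω, fun κ => a • c κ, fun κ hκ => ⟨(h κ hκ).1.smul a, (h κ hκ).2⟩, fun p => ?_⟩
    rw [smul_apply, hf, smul_eq_mul, Finset.mul_sum]
    exact Finset.sum_congr rfl fun κ _ => by rw [smul_apply, smul_eq_mul, mul_assoc]

theorem mem_homogeneousSubmodule {ω : Fin d → ℝ} {n : Fin d → ℤ} {f : 𝓢(Phase d, ℂ)} :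
    f ∈ homogeneousSubmodule ω n ↔ IsHomogeneous ω n f := Iff.rfl

/-! #### Uniqueness -/

/-- The rotation by the angle `θⱼ` in each plane `(xⱼ, yⱼ)`. -/
def phaseRotation (ω θ : Fin d → ℝ) (p : Phase d) : Phase d :=
  (WithLp.toLp 2 fun j => Real.cos (θ j) * p.1 j - Real.sin (θ j) * yCoord ω j p,
    WithLp.toLp 2 fun j => ω j * (Real.sin (θ j) * p.1 j + Real.cos (θ j) * yCoord ω j p))

theorem fst_phaseRotation (ω θ : Fin d → ℝ) (p : Phase d) (j : Fin d) :
    (phaseRotation ω θ p).1 j = Real.cos (θ j) * p.1 j - Real.sin (θ j) * yCoord ω j p := rfl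

theorem yCoord_phaseRotation {ω : Fin d → ℝ} (hω : ∀ j, ω j ≠ 0) (θ : Fin d → ℝ) (p : Phase d)
    (j : Fin d) : yCoord ω j (phaseRotation ω θ p) =
      Real.sin (θ j) * p.1 j + Real.cos (θ j) * yCoord ω j p := by
  have : yCoord ω j (phaseRotation ω θ p) =
    ω j * (Real.sin (θ j) * p.1 j + Real.cos (θ j) * yCoord ω j p) / ω j := rfl
  rw [this, mul_div_cancel_left₀ _ (hω j)]

theorem zCoord_phaseRotation {ω : Fin d → ℝ} (hω : ∀ j, ω j ≠ 0) (θ : Fin d → ℝ) (p : Phase d)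
    (j : Fin d) : zCoord ω j (phaseRotation ω θ p) =
      Complex.exp (θ j * Complex.I) * zCoord ω j p := by
  rw [zCoord, zCoord, yCoord_phaseRotation hω, fst_phaseRotation, Complex.exp_mul_I]
  push_cast
  linear_combination (-(Complex.sin (θ j) * yCoord ω j p) / (√2 : ℝ)) * Complex.I_sq

theorem wCoord_phaseRotation {ω : Fin d → ℝ} (hω : ∀ j, ω j ≠ 0) (θ : Fin d → ℝ) (p : Phase d)
    (j : Fin d) : wCoord ω j (phaseRotation ω θ p) =
      Complex.exp (-(θ j * Complex.I)) * wCoord ω j p := by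
  rw [wCoord, wCoord, yCoord_phaseRotation hω, fst_phaseRotation, ← neg_mul, Complex.exp_mul_I,
    Complex.cos_neg, Complex.sin_neg]
  push_cast
  linear_combination ((Complex.sin (θ j) * p.1 j) / (√2 : ℝ)) * Complex.I_sq

theorem IsActionFunction.apply_phaseRotation {ω : Fin d → ℝ} (hω : ∀ j, ω j ≠ 0)
    {f : 𝓢(Phase d, ℂ)} (hf : IsActionFunction ω f) (θ : Fin d → ℝ) (p : Phase d) :
    f (phaseRotation ω θ p) = f p := by
  obtain ⟨g, -, hg⟩ := hf
  rw [hg, hg]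
  congr 1
  funext j
  rw [yCoord_phaseRotation hω, fst_phaseRotation]
  linear_combination (p.1 j ^ 2 + yCoord ω j p ^ 2) / 2 * Real.sin_sq_add_cos_sq (θ j)

/-- The character `θ ↦ e^{i ⟨n, θ⟩}`. -/
def torusCharacter (n : Fin d → ℤ) : Multiplicative (Fin d → ℝ) →* ℂ where
  toFun θ := Complex.exp (∑ j, (n j : ℂ) * (θ.toAdd j : ℂ) * Complex.I)
  map_one' := by simp
  map_mul' θ θ' := by
    rw [← Complex.exp_add, ← Finset.sum_add_distrib]
    congr 1
    refine Finset.sum_congr rfl fun j _ => ?_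
    simp only [toAdd_mul, Pi.add_apply]
    push_cast
    ring

/-- If n and m differ at j, the rotation by π/(nⱼ - mⱼ) in the j-th plane gives the two characters
the ratio -1. -/
theorem torusCharacter_injective : Function.Injective (torusCharacter (d := d)) := by
  intro n m h
  by_contra hne
  obtain ⟨j, hj⟩ := Function.ne_iff.1 hne
  have hk : ((n j : ℂ) - (m j : ℂ)) ≠ 0 := sub_ne_zero.2 (by exact_mod_cast hj)
  have h1 := DFunLike.congr_fun h
    (Multiplicative.ofAdd (Pi.single j (Real.pi / ((n j : ℝ) - (m j : ℝ)))))
  have e : ∀ k : Fin d → ℤ, torusCharacter k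
      (Multiplicative.ofAdd (Pi.single j (Real.pi / ((n j : ℝ) - (m j : ℝ))))) =
      Complex.exp ((k j : ℂ) * (Real.pi / ((n j : ℂ) - (m j : ℂ))) * Complex.I) := by
    intro k
    change Complex.exp _ = _
    congr 1
    rw [Finset.sum_eq_single j]
    · simp
    · intro i _ hi
      simp [Pi.single_eq_of_ne hi]
    · simp
  rw [e, e, Complex.exp_eq_exp_iff_exp_sub_eq_one] at h1
  have h2 : (n j : ℂ) * (Real.pi / ((n j : ℂ) - (m j : ℂ))) * Complex.I -
      (m j : ℂ) * (Real.pi / ((n j : ℂ) - (m j : ℂ))) * Complex.I = Real.pi * Complex.I := by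
    field_simp
  rw [h2, Complex.exp_pi_mul_I] at h1
  norm_num at h1

/-- Under rotation zⱼ and wⱼ have opposite weights e^{±iθⱼ} and action functions are invariant, so
z^k w^l has weight k - l. -/
theorem IsHomogeneous.apply_phaseRotation {ω : Fin d → ℝ} (hω : ∀ j, ω j ≠ 0) {n : Fin d → ℤ}
    {f : 𝓢(Phase d, ℂ)} (hf : IsHomogeneous ω n f) (θ : Fin d → ℝ) (p : Phase d) :
    f (phaseRotation ω θ p) = f p * torusCharacter n (Multiplicative.ofAdd θ) := by
  obtain ⟨Ω, c, h, hf⟩ := hf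
  rw [hf, hf, Finset.sum_mul]
  refine Finset.sum_congr rfl fun κ hκ => ?_
  rw [(h κ hκ).1.apply_phaseRotation hω, mul_assoc]
  congr 1
  change _ = _ * Complex.exp (∑ j, (n j : ℂ) * (θ j : ℂ) * Complex.I)
  rw [Complex.exp_sum, ← Finset.prod_mul_distrib]
  refine Finset.prod_congr rfl fun j _ => ?_
  rw [zCoord_phaseRotation hω, wCoord_phaseRotation hω, mul_pow, mul_pow, ← Complex.exp_nat_mul,
    ← Complex.exp_nat_mul]
  have e : (n j : ℂ) * (θ j : ℂ) * Complex.I =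
      (κ.1 j : ℂ) * (θ j * Complex.I) + (κ.2 j : ℂ) * -(θ j * Complex.I) := by
    rw [← (h κ hκ).2 j]
    push_cast
    ring
  rw [e, Complex.exp_add]
  ring

/-- Homogeneous functions of different degrees are linearly independent. -/
theorem eq_zero_of_finsum_homogeneous_eq_zero {ω : Fin d → ℝ} (hω : ∀ j, ω j ≠ 0)
    {f : (Fin d → ℤ) → 𝓢(Phase d, ℂ)} (hf : ∀ n, IsHomogeneous ω n (f n))
    (hfin : {n | f n ≠ 0}.Finite) (h : ∀ p, ∑ᶠ n, f n p = 0) (n : Fin d → ℤ) : f n = 0 := by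
  have hsum : ∀ p, ∑ n ∈ hfin.toFinset, f n p = 0 := fun p => by
    rw [← h p]
    refine (finsum_eq_sum_of_support_subset _ fun n hn => ?_).symm
    rw [Set.Finite.coe_toFinset]
    intro h0
    rw [Function.mem_support, h0] at hn
    exact hn rfl
  -- Dedekind's independence of characters. At fixed p, evaluating the vanishing sum at all rotated
  -- points gives a linear relation between characters with coefficients f n p.
  have hli := (linearIndependent_monoidHom (Multiplicative (Fin d → ℝ)) ℂ).comp _
    (torusCharacter_injective (d := d))
  by_contra hn
  refine hn (SchwartzMap.ext fun p => ?_)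
  refine linearIndependent_iff'.1 hli hfin.toFinset (fun n => f n p) ?_ n (by simpa using hn)
  funext θ
  rw [Finset.sum_apply, Pi.zero_apply, ← hsum (phaseRotation ω θ.toAdd p)]
  refine Finset.sum_congr rfl fun m _ => ?_
  rw [(hf m).apply_phaseRotation hω]
  rfl

/-! #### Existence -/

theorem hasTemperateGrowth_fst_coord (j : Fin d) :
    (fun p : Phase d => (p.1 j : ℂ)).HasTemperateGrowth :=
  (Complex.ofRealCLM.comp ((EuclideanSpace.proj j : Config d →L[ℝ] ℝ).comp
    (ContinuousLinearMap.fst ℝ (Config d) (Config d)))).hasTemperateGrowth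

theorem hasTemperateGrowth_yCoord (ω : Fin d → ℝ) (j : Fin d) :
    (fun p : Phase d => (yCoord ω j p : ℂ)).HasTemperateGrowth := by
  have h := ((ω j)⁻¹ • Complex.ofRealCLM.comp ((EuclideanSpace.proj j : Config d →L[ℝ] ℝ).comp
    (ContinuousLinearMap.snd ℝ (Config d) (Config d)))).hasTemperateGrowth
  convert h using 1
  funext p
  simp [yCoord, div_eq_inv_mul]

theorem hasTemperateGrowth_zCoord (ω : Fin d → ℝ) (j : Fin d) :
    (zCoord ω j).HasTemperateGrowth := by
  have h1 := hasTemperateGrowth_fst_coord (d := d) j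
  have h2 := hasTemperateGrowth_yCoord ω j
  unfold zCoord
  simp only [div_eq_mul_inv]
  fun_prop

theorem hasTemperateGrowth_wCoord (ω : Fin d → ℝ) (j : Fin d) :
    (wCoord ω j).HasTemperateGrowth := by
  have h1 := hasTemperateGrowth_fst_coord (d := d) j
  have h2 := hasTemperateGrowth_yCoord ω j
  unfold wCoord
  simp only [div_eq_mul_inv]
  fun_prop

theorem IsHomogeneous.zCoord_mul {ω : Fin d → ℝ} {n : Fin d → ℤ} {f : 𝓢(Phase d, ℂ)}
    (hf : IsHomogeneous ω n f) (j : Fin d) :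
    IsHomogeneous ω (n + Pi.single j 1) (SchwartzMap.smulLeftCLM ℂ (zCoord ω j) f) := by
  classical
  obtain ⟨Ω, c, h, hf⟩ := hf
  have hinj : Function.Injective fun κ : (Fin d → ℕ) × (Fin d → ℕ) =>
      (κ.1 + Pi.single j 1, κ.2) := by
    rintro ⟨a, b⟩ ⟨a', b'⟩ h
    simpa using h
  -- The truncated subtraction is harmless: on the image of the index shift it is a true inverse.
  refine ⟨Ω.image fun κ => (κ.1 + Pi.single j 1, κ.2), fun κ => c (κ.1 - Pi.single j 1, κ.2),
    fun κ hκ => ?_, fun p => ?_⟩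
  · obtain ⟨κ, hκΩ, rfl⟩ := Finset.mem_image.1 hκ
    refine ⟨by simpa using (h κ hκΩ).1, fun i => ?_⟩
    have := (h κ hκΩ).2 i
    by_cases hi : i = j
    · subst hi; simp; omega
    · simp [Pi.single_eq_of_ne hi]; omega
  · rw [SchwartzMap.smulLeftCLM_apply_apply (hasTemperateGrowth_zCoord ω j), hf,
      Finset.sum_image hinj.injOn, smul_eq_mul, Finset.mul_sum]
    refine Finset.sum_congr rfl fun κ _ => ?_
    simp only [add_tsub_cancel_right, Prod.mk.eta, Pi.add_apply, pow_add]
    have e : ∏ i, zCoord ω i p ^ (Pi.single j 1 : Fin d → ℕ) i = zCoord ω j p := by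
      rw [Finset.prod_eq_single j]
      · simp
      · intro i _ hi
        simp [Pi.single_eq_of_ne hi]
      · simp
    simp only [Finset.prod_mul_distrib, e]
    ring

theorem IsHomogeneous.wCoord_mul {ω : Fin d → ℝ} {n : Fin d → ℤ} {f : 𝓢(Phase d, ℂ)}
    (hf : IsHomogeneous ω n f) (j : Fin d) :
    IsHomogeneous ω (n - Pi.single j 1) (SchwartzMap.smulLeftCLM ℂ (wCoord ω j) f) := by
  classical
  obtain ⟨Ω, c, h, hf⟩ := hf
  have hinj : Function.Injective fun κ : (Fin d → ℕ) × (Fin d → ℕ) =>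
      (κ.1, κ.2 + Pi.single j 1) := by
    rintro ⟨a, b⟩ ⟨a', b'⟩ h
    simpa using h
  refine ⟨Ω.image fun κ => (κ.1, κ.2 + Pi.single j 1), fun κ => c (κ.1, κ.2 - Pi.single j 1),
    fun κ hκ => ?_, fun p => ?_⟩
  · obtain ⟨κ, hκΩ, rfl⟩ := Finset.mem_image.1 hκ
    refine ⟨by simpa using (h κ hκΩ).1, fun i => ?_⟩
    have := (h κ hκΩ).2 i
    by_cases hi : i = j
    · subst hi; simp; omega
    · simp [Pi.single_eq_of_ne hi]; omega
  · rw [SchwartzMap.smulLeftCLM_apply_apply (hasTemperateGrowth_wCoord ω j), hf,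
      Finset.sum_image hinj.injOn, smul_eq_mul, Finset.mul_sum]
    refine Finset.sum_congr rfl fun κ _ => ?_
    simp only [add_tsub_cancel_right, Prod.mk.eta, Pi.add_apply, pow_add]
    have e : ∏ i, wCoord ω i p ^ (Pi.single j 1 : Fin d → ℕ) i = wCoord ω j p := by
      rw [Finset.prod_eq_single j]
      · simp
      · intro i _ hi
        simp [Pi.single_eq_of_ne hi]
      · simp
    simp only [Finset.prod_mul_distrib, e]
    ring

/-- The temperate functions that preserve the span of the homogeneous functions. -/
def homogeneousMultipliers (ω : Fin d → ℝ) : Submonoid (Phase d → ℂ) where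
  carrier := {g | g.HasTemperateGrowth ∧ ∀ f ∈ ⨆ n, homogeneousSubmodule ω n,
    SchwartzMap.smulLeftCLM ℂ g f ∈ ⨆ n, homogeneousSubmodule ω n}
  one_mem' := ⟨.const 1, fun f hf => by
    rwa [show (1 : Phase d → ℂ) = fun _ => 1 from rfl, SchwartzMap.smulLeftCLM_const, one_smul]⟩
  mul_mem' := by
    rintro g g' ⟨hg, h⟩ ⟨hg', h'⟩
    refine ⟨hg.mul hg', fun f hf => ?_⟩
    rw [← SchwartzMap.smulLeftCLM_smulLeftCLM_apply hg hg']
    exact h _ (h' f hf)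

theorem zCoord_mem_homogeneousMultipliers (ω : Fin d → ℝ) (j : Fin d) :
    zCoord ω j ∈ homogeneousMultipliers ω := by
  refine ⟨hasTemperateGrowth_zCoord ω j, fun f hf => ?_⟩
  refine Submodule.iSup_induction _ (motive := fun f => SchwartzMap.smulLeftCLM ℂ (zCoord ω j) f ∈
    ⨆ n, homogeneousSubmodule ω n) hf (fun n g hg => ?_) (by simp) fun g g' h h' => ?_
  · exact Submodule.mem_iSup_of_mem _ (IsHomogeneous.zCoord_mul hg j)
  · rw [map_add]; exact add_mem h h'

theorem wCoord_mem_homogeneousMultipliers (ω : Fin d → ℝ) (j : Fin d) :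
    wCoord ω j ∈ homogeneousMultipliers ω := by
  refine ⟨hasTemperateGrowth_wCoord ω j, fun f hf => ?_⟩
  refine Submodule.iSup_induction _ (motive := fun f => SchwartzMap.smulLeftCLM ℂ (wCoord ω j) f ∈
    ⨆ n, homogeneousSubmodule ω n) hf (fun n g hg => ?_) (by simp) fun g g' h h' => ?_
  · exact Submodule.mem_iSup_of_mem _ (IsHomogeneous.wCoord_mul hg j)
  · rw [map_add]; exact add_mem h h'

theorem mem_homogeneousMultipliers_of_eq {ω : Fin d → ℝ} {j : Fin d} {g : Phase d → ℂ}
    (hg : g.HasTemperateGrowth) (a b : ℂ)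
    (h : ∀ p, g p = a * zCoord ω j p + b * wCoord ω j p) : g ∈ homogeneousMultipliers ω := by
  refine ⟨hg, fun f hf => ?_⟩
  have e : SchwartzMap.smulLeftCLM ℂ g f = a • SchwartzMap.smulLeftCLM ℂ (zCoord ω j) f +
      b • SchwartzMap.smulLeftCLM ℂ (wCoord ω j) f := by
    ext p
    rw [add_apply, smul_apply, smul_apply, SchwartzMap.smulLeftCLM_apply_apply hg,
      SchwartzMap.smulLeftCLM_apply_apply (hasTemperateGrowth_zCoord ω j),
      SchwartzMap.smulLeftCLM_apply_apply (hasTemperateGrowth_wCoord ω j), h]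
    simp only [smul_eq_mul]
    ring
  rw [e]
  exact add_mem (Submodule.smul_mem _ _ ((zCoord_mem_homogeneousMultipliers ω j).2 f hf))
    (Submodule.smul_mem _ _ ((wCoord_mem_homogeneousMultipliers ω j).2 f hf))

/-- Since x = (z - iw)/√2 and y = (w - iz)/√2, the coordinates are homogeneous multipliers. These
form a monoid, so monomials in x and y are multipliers too; they act on action functions, which have
degree 0. -/
theorem complexify_mem_iSup_homogeneousSubmodule {ω : Fin d → ℝ} {f : 𝓢(Phase d, ℝ)}
    (hf : IsAdmissible ω f) : complexify f ∈ ⨆ n, homogeneousSubmodule ω n := by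
  obtain ⟨Ω, b, hb, hf⟩ := hf
  have hs : ((√2 : ℝ) : ℂ) * (√2 : ℝ) = 2 := by
    rw [← Complex.ofReal_mul, Real.mul_self_sqrt (by norm_num)]; norm_num
  have hs0 : ((√2 : ℝ) : ℂ) ≠ 0 := by
    intro h; rw [h] at hs; norm_num at hs
  have hx : ∀ j, (fun p : Phase d => (p.1 j : ℂ)) ∈ homogeneousMultipliers ω := fun j =>
    mem_homogeneousMultipliers_of_eq (j := j) (hasTemperateGrowth_fst_coord j)
      (1 / (√2 : ℝ)) (-Complex.I / (√2 : ℝ)) fun p => by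
        rw [zCoord, wCoord]
        field_simp
        rw [pow_two, hs]
        linear_combination (p.1 j : ℂ) * Complex.I_sq
  have hy : ∀ j, (fun p : Phase d => (yCoord ω j p : ℂ)) ∈ homogeneousMultipliers ω := fun j =>
    mem_homogeneousMultipliers_of_eq (j := j) (hasTemperateGrowth_yCoord ω j)
      (-Complex.I / (√2 : ℝ)) (1 / (√2 : ℝ)) fun p => by
        rw [zCoord, wCoord]
        field_simp
        rw [pow_two, hs]
        linear_combination (yCoord ω j p : ℂ) * Complex.I_sq
  have hprod : ∀ κ : (Fin d → ℕ) × (Fin d → ℕ), (∏ j, ((fun p : Phase d => (p.1 j : ℂ)) ^ κ.1 j *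
      (fun p : Phase d => (yCoord ω j p : ℂ)) ^ κ.2 j)) ∈ homogeneousMultipliers ω := fun κ =>
    prod_mem fun j _ => mul_mem (pow_mem (hx j) _) (pow_mem (hy j) _)
  have e : complexify f = ∑ κ ∈ Ω, SchwartzMap.smulLeftCLM ℂ
      (∏ j, ((fun p : Phase d => (p.1 j : ℂ)) ^ κ.1 j *
        (fun p : Phase d => (yCoord ω j p : ℂ)) ^ κ.2 j)) (complexify (b κ)) := by
    ext p
    rw [sum_apply, complexify_apply, hf, Complex.ofReal_sum]
    refine Finset.sum_congr rfl fun κ _ => ?_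
    rw [SchwartzMap.smulLeftCLM_apply_apply (hprod κ).1]
    simp [Finset.prod_apply, mul_comm]
  rw [e]
  refine sum_mem fun κ hκ => (hprod κ).2 _ (Submodule.mem_iSup_of_mem 0 ?_)
  exact ⟨{(0, 0)}, fun _ => complexify (b κ), fun κ' hκ' =>
    ⟨(hb κ hκ).complexify, by simp [Finset.mem_singleton.1 hκ']⟩, fun p => by simp⟩

theorem exists_homogeneousDecomposition {ω : Fin d → ℝ} {B : ℕ → 𝓢(Phase d, ℝ)}
    (hB : ∀ m, IsAdmissible ω (B m)) :
    ∃ Bn : (Fin d → ℤ) → ℕ → 𝓢(Phase d, ℂ), IsHomogeneousDecomposition ω B Bn := by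
  choose f hf hs using fun m => (Submodule.mem_iSup_iff_exists_finsupp _ _).1
    (complexify_mem_iSup_homogeneousSubmodule (hB m))
  refine ⟨fun n m => f m n, fun m => ⟨fun n => hf m n, ?_, fun p => ?_⟩⟩
  · exact (f m).hasFiniteSupport
  · rw [← complexify_apply, ← hs m, Finsupp.sum, sum_apply]
    refine (finsum_eq_sum_of_support_subset _ fun n hn => ?_).symm
    rw [Finset.mem_coe, Finsupp.mem_support_iff]
    intro h0
    rw [Function.mem_support, h0] at hn
    exact hn rfl

theorem IsHomogeneousDecomposition.unique {ω : Fin d → ℝ} (hω : ∀ j, ω j ≠ 0)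
    {B : ℕ → 𝓢(Phase d, ℝ)} {Bn Bn' : (Fin d → ℤ) → ℕ → 𝓢(Phase d, ℂ)}
    (h : IsHomogeneousDecomposition ω B Bn) (h' : IsHomogeneousDecomposition ω B Bn') :
    Bn = Bn' := by
  funext n m
  refine sub_eq_zero.1 (eq_zero_of_finsum_homogeneous_eq_zero hω
    (f := fun n => Bn n m - Bn' n m) (fun n => ?_) ?_ (fun p => ?_) n)
  · exact sub_mem (mem_homogeneousSubmodule.2 ((h m).1 n))
      (mem_homogeneousSubmodule.2 ((h' m).1 n))
  · refine ((h m).2.1.union (h' m).2.1).subset fun n hn => ?_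
    by_contra hc
    simp only [Set.mem_union, Set.mem_ofPred_eq, not_or, not_not] at hc
    exact hn (by rw [hc.1, hc.2, sub_zero])
  · simp only [sub_apply]
    rw [finsum_sub_distrib, ← (h m).2.2 p, ← (h' m).2.2 p, sub_self]
    · exact (h m).2.1.subset fun n hn h0 => hn (by simp [h0])
    · exact (h' m).2.1.subset fun n hn h0 => hn (by simp [h0])

/-- Independence of the degrees passes the condition of order at least 1 from B to each component;
this is what bounds the length of contributing words. -/
theorem IsHomogeneousDecomposition.apply_zero {ω : Fin d → ℝ} (hω : ∀ j, ω j ≠ 0)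
    {B : ℕ → 𝓢(Phase d, ℝ)} {Bn : (Fin d → ℤ) → ℕ → 𝓢(Phase d, ℂ)}
    (h : IsHomogeneousDecomposition ω B Bn) (hB0 : B 0 = 0) (n : Fin d → ℤ) : Bn n 0 = 0 :=
  eq_zero_of_finsum_homogeneous_eq_zero hω (f := fun n => Bn n 0) (h 0).1 (h 0).2.1
    (fun p => by rw [← (h 0).2.2 p, hB0]; simp) n

end Decomposition

end WeylBNF
end

open WeylBNF
theorem mainTheorem4 {d : ℕ} (hd : 1 ≤ d) (ω : Fin d → ℝ) (hω : ∀ j, 0 < ω j)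
    (F G : Mould ℂ ℂ) (hF : IsAlternal F) (hG : IsAlternal G) (hFG : MouldEquation id F G)
    (B : ℕ → 𝓢(Phase d, ℝ)) (hB : ∀ m, IsAdmissible ω (B m)) (hB0 : B 0 = 0) :
    (∃! Bn : (Fin d → ℤ) → ℕ → 𝓢(Phase d, ℂ), IsHomogeneousDecomposition ω B Bn) ∧
    ∀ Bn : (Fin d → ℤ) → ℕ → 𝓢(Phase d, ℂ), IsHomogeneousDecomposition ω B Bn →
      ∃ σ : ℝ → ℕ → 𝓢(Phase d, ℂ),
        (∀ ħ : ℝ, 0 < ħ → ∀ m : ℕ,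
          IsWeylSymbol ħ (quantumZ ω F Bn ħ m) (σ ħ m) ∧
          ∀ τ : 𝓢(Phase d, ℂ), IsWeylSymbol ħ (quantumZ ω F Bn ħ m) τ → τ = σ ħ m) ∧
        ∀ m : ℕ, Tendsto (fun ħ => σ ħ m) (𝓝[>] 0) (𝓝 (classicalZ ω F Bn m)) := by
  have hω' : ∀ j, ω j ≠ 0 := fun j => (hω j).ne'
  obtain ⟨Bn₀, h₀⟩ := exists_homogeneousDecomposition hB
  exact ⟨⟨Bn₀, h₀, fun Bn h => h.unique hω' h₀⟩, fun Bn h =>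
    exists_symbol_quantumZ ω F (h.apply_zero hω' hB0) fun m => (h m).2.1⟩
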